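/- **Notation.** Let $\mathbb{T}=\mathbb{R}/2\pi\mathbb{Z}$ with normalized Lebesgue measure $\frac{dx}{2\pi}$. For $f\in L^1(\mathbb{T})$ let $f_n=\frac1{2\pi}\int_0^{2\pi}f(x)e^{-inx}\,dx$, $n\in\mathbb{Z}$. Let $\ell^2=\ell^2(\{0,1,2,\dots\})$ with standard basis $e_0,e_1,\dots$, and let $[A]_{jk}$, $j,k\ge 0$, be the matrix entries of a bounded operator $A$ on $\ell^2$. For $a\in L^\infty(\mathbb{T})$ the Toeplitz operator $T(a)$ is the bounded operator on $\ell^2$ with matrix $(a_{j-k})_{j,k\ge0}$. Let $P_n(x_0,x_1,\dots)=(x_0,\dots,x_{n-1},0,0,\dots)$. Operators of the form $A=P_nAP_n$ are identified with $n\times n$ matrices; $\det A$ is the determinant of this matrix, and $A^{-1}$ denotes the operator on $\ell^2$ which is the inverse of $A$ on the range of $P_n$ and is zero on the range of $I-P_n$. The Krein algebra $K$ is the set of all $f\in L^\infty(\mathbb{T})$ with $\sum_{n\in\mathbb{Z}}(1+|n|)|f_n|^2<\infty$, with the norm $\|f\|_\infty+\big(\sum_{n}(1+|n|)|f_n|^2\big)^{1/2}$.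 Let $B$ be a complex unital Banach algebra which is continuously embedded in $L^\infty(\mathbb{T})$ (as a subalgebra with the constant function $1$ as its unit). Let $\Phi(B)$ be the set of all $a\in B$ such that $T(a)$ is invertible on $\ell^2$. $B$ is called *suitable* if (a) $B$ is continuously embedded in $K$, and (b) every $a\in\Phi(B)$ has an inverse $a^{-1}\in B$, and $a^{-1}\in\Phi(B)$. **Proposition 4.3.** Let $B$ be a suitable Banach algebra. (i) For every $a\in\Phi(B)$ the constant $G[a]:=[T(a^{-1})^{-1}]_{00}$ is nonzero. (ii) For $a\in\Phi(B)$ put $A_n=A_n(a)=P_nT(a^{-1})^{-1}P_n$. Then $\det A_n=G[a]^n$ for all $n\ge0$ (in particular $A_n$ is invertible as an $n\times n$ matrix), and $$A_n^{-1}\to T(a^{-1}),\qquad (A_n^*)^{-1}\to T(a^{-1})^*$$ strongly on $\ell^2$ as $n\to\infty$. Moreover, the mappings $\Lambda_n:\Phi(B)\to\mathcal{L}(\ell^2)$, $a\mapsto A_n(a)^{-1}$, $n\ge 0$, are equicontinuous at each point of $\Phi(B)$, with respect to the norm of $B$ and the operator norm. (iii) If $b\in B$, then the exponential $e^b$ of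 $b$ in $B$, which is a.e. equal to the pointwise exponential $e^{b(x)}$, belongs to $\Phi(B)$, and $G[e^b]=e^{b_0}$. -/

import Mathlib

open MeasureTheory AddCircle Filter Topology
open scoped ENNReal ComplexConjugate InnerProductSpace

noncomputable section

namespace Szego

instance twoPiPos : Fact (0 < 2 * Real.pi) := ⟨Real.two_pi_pos⟩

/-- The circle `ℝ / 2πℤ`; it carries the normalized Haar measure `dx / 2π`. -/
abbrev T : Type := AddCircle (2 * Real.pi)

/-- `L^∞` of the circle. -/
abbrev Linf : Type := Lp ℂ ∞ (haarAddCircle : Measure T)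

/-- `L²` of the circle. -/
abbrev L2 : Type := Lp ℂ 2 (haarAddCircle : Measure T)

/-- `ℓ²` over the nonnegative integers. -/
abbrev Ell2 : Type := lp (fun _ : ℕ => ℂ) 2

/-- The standard basis vectors of `ℓ²`. -/
def e (k : ℕ) : Ell2 := lp.single 2 k (1 : ℂ)

/-- The entry in row `j` and column `k` of the matrix representation of an operator on `ℓ²`. -/
def entry (A : Ell2 →L[ℂ] Ell2) (j k : ℕ) : ℂ := A (e k) j

/-! ### Toeplitz operators -/

/-- The functions `exp(ikx)`, `k ≥ 0`, are orthonormal. -/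
theorem orthonormal_fourier_nat :
    Orthonormal ℂ (fun k : ℕ => (fourierLp 2 (k : ℤ) : L2)) :=
  (orthonormal_fourier (T := 2 * Real.pi)).comp _ Nat.cast_injective

/-- The isometry `(x_k) ↦ ∑ x_k exp(ikx)` of `ℓ²` onto the Hardy space in `L²`. -/
def hardyEmb : Ell2 →ₗᵢ[ℂ] L2 := orthonormal_fourier_nat.orthogonalFamily.linearIsometry

/-- Multiplication by the symbol `a ∈ L^∞` on `L²`. -/
def mulOp (a : Linf) : L2 →L[ℂ] L2 :=
  (ContinuousLinearMap.mul ℂ ℂ).holderL haarAddCircle ∞ 2 2 a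

/-- The Toeplitz operator `T(a)`, i.e. the compression to the Hardy space of the multiplication by
`a`, transported to `ℓ²`. Its matrix is `(a_{j-k})`, see `entry_toeplitz`. -/
def toeplitz (a : Linf) : Ell2 →L[ℂ] Ell2 :=
  (ContinuousLinearMap.adjoint hardyEmb.toContinuousLinearMap) ∘L mulOp a ∘L
    hardyEmb.toContinuousLinearMap

theorem hardyEmb_e (k : ℕ) : hardyEmb (e k) = (fourierLp 2 (k : ℤ) : L2) := by
  simp [hardyEmb, e, OrthogonalFamily.linearIsometry_apply_single]

theorem entry_toeplitz (a : Linf) (j k : ℕ) :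
    entry (toeplitz a) j k = fourierCoeff (a : T → ℂ) ((j : ℤ) - k) := by
  have h1 : entry (toeplitz a) j k = inner ℂ (e j) (toeplitz a (e k)) := by
    simp [entry, e, lp.inner_single_left]
  rw [h1, toeplitz]
  simp only [ContinuousLinearMap.comp_apply, ContinuousLinearMap.adjoint_inner_right,
    LinearIsometry.coe_toContinuousLinearMap, hardyEmb_e]
  rw [L2.inner_def, fourierCoeff]
  apply integral_congr_ae
  filter_upwards [coeFn_fourierLp (T := 2 * Real.pi) 2 (j : ℤ),
    coeFn_fourierLp (T := 2 * Real.pi) 2 (k : ℤ),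
    (ContinuousLinearMap.mul ℂ ℂ).coeFn_holder (r := 2) a (fourierLp 2 (k : ℤ) : L2)]
    with x h2 h3 h4
  have h5 : (mulOp a (fourierLp 2 (k : ℤ) : L2) : T → ℂ) x = a x * fourier (k : ℤ) x := by
    rw [← h3]; exact h4
  rw [h5, h2]
  simp only [RCLike.inner_apply, smul_eq_mul, ← fourier_neg, neg_sub]
  rw [sub_eq_add_neg, fourier_add]
  ring

/-! ### Suitable Banach algebras -/

/-- A unital complex Banach algebra `B` continuously embedded in `L^∞`: the bounded linear map `ι`
is injective, and it respects the unit and the (pointwise) multiplication. -/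
structure IsBanachAlgEmbedding {B : Type*} [NormedRing B] [NormedAlgebra ℂ B] (ι : B →L[ℂ] Linf) :
    Prop where
  injective : Function.Injective ι
  map_one : (ι 1 : T → ℂ) =ᵐ[haarAddCircle] fun _ => 1
  map_mul : ∀ a b : B, (ι (a * b) : T → ℂ) =ᵐ[haarAddCircle] fun x => ι a x * ι b x

/-- The set `Φ(B)` of all `a ∈ B` such that `T(a)` is invertible on `ℓ²`. -/
def Phi {B : Type*} [NormedRing B] [NormedAlgebra ℂ B] (ι : B →L[ℂ] Linf) : Set B :=
  {a | IsUnit (toeplitz (ι a))}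

/-- The terms of the squared norm of the space of all functions `f` with
`∑ (1 + |n|) |f_n|² < ∞`. -/
def halfTerm (f : T → ℂ) (n : ℤ) : ℝ := (1 + |(n : ℝ)|) * ‖fourierCoeff f n‖ ^ 2

/-- Membership of a bounded function in the Krein algebra `K`. -/
def MemKrein (f : Linf) : Prop := Summable (halfTerm f)

/-- The norm of the Krein algebra `K`. -/
def kreinNorm (f : Linf) : ℝ := ‖f‖ + Real.sqrt (∑' n : ℤ, halfTerm f n)

/-- `B` is suitable: it is continuously embedded in the Krein algebra, and every `a ∈ Φ(B)` has an
inverse in `B`, which again lies in `Φ(B)`. -/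
structure IsSuitable {B : Type*} [NormedRing B] [NormedAlgebra ℂ B] (ι : B →L[ℂ] Linf) :
    Prop where
  krein : ∃ C : ℝ, ∀ b : B, MemKrein (ι b) ∧ kreinNorm (ι b) ≤ C * ‖b‖
  inverse : ∀ a ∈ Phi ι, IsUnit a ∧ Ring.inverse a ∈ Phi ι

/-! ### Finite sections -/

/-- The operator on `ℓ²` whose matrix has the `n × n` upper-left block `M` and is zero elsewhere. -/
def ofCorner (n : ℕ) (M : Matrix (Fin n) (Fin n) ℂ) : Ell2 →L[ℂ] Ell2 :=
  ∑ j : Fin n, ∑ k : Fin n, M j k • (innerSL ℂ (e k)).smulRight (e j)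

/-- The `n × n` upper-left block of the matrix of an operator. -/
def corner (n : ℕ) (A : Ell2 →L[ℂ] Ell2) : Matrix (Fin n) (Fin n) ℂ :=
  Matrix.of fun j k => entry A j k

/-- The projection `P_n : (x₀, x₁, …) ↦ (x₀, …, x_{n-1}, 0, 0, …)`. -/
def P (n : ℕ) : Ell2 →L[ℂ] Ell2 := ∑ k : Fin n, (innerSL ℂ (e k)).smulRight (e k)

/-- For an operator `A = P_n A P_n`, identified with an `n × n` matrix, the operator corresponding to
the inverse matrix, i.e. the inverse of `A` on the range of `P_n`, extended by zero. It is
meaningful if the block `corner n A` has nonzero determinant, see `sectionInv_mul`. -/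
def sectionInv (n : ℕ) (A : Ell2 →L[ℂ] Ell2) : Ell2 →L[ℂ] Ell2 := ofCorner n (corner n A)⁻¹

theorem inner_e (k : ℕ) (x : Ell2) : inner ℂ (e k) x = x k := by
  simp [e, lp.inner_single_left]

theorem e_apply (k i : ℕ) : e k i = if i = k then 1 else 0 := by
  simp [e, lp.single_apply, Pi.single_apply]

theorem ofCorner_apply (n : ℕ) (M : Matrix (Fin n) (Fin n) ℂ) (x : Ell2) :
    ofCorner n M x = ∑ j : Fin n, (∑ k : Fin n, M j k * x k) • e j := by
  simp [ofCorner, inner_e, smul_smul, Finset.sum_smul]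

theorem P_eq (n : ℕ) (x : Ell2) : P n x = ∑ k : Fin n, x k • e k := by
  simp [P, inner_e]

theorem P_apply (n : ℕ) (x : Ell2) (i : ℕ) : P n x i = if i < n then x i else 0 := by
  rw [P_eq, lp.coeFn_sum, Finset.sum_apply]
  simp only [lp.coeFn_smul, Pi.smul_apply, e_apply, smul_eq_mul, mul_ite, mul_one, mul_zero]
  rw [Fin.sum_univ_eq_sum_range (fun k => if i = k then x k else 0) n]
  simp

theorem ofCorner_corner (n : ℕ) (A : Ell2 →L[ℂ] Ell2) :
    ofCorner n (corner n A) = P n ∘L A ∘L P n := by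
  ext1 x
  rw [ofCorner_apply, ContinuousLinearMap.comp_apply, ContinuousLinearMap.comp_apply, P_eq n (A _)]
  refine Finset.sum_congr rfl fun j _ => ?_
  congr 1
  rw [P_eq, map_sum, lp.coeFn_sum, Finset.sum_apply]
  refine Finset.sum_congr rfl fun k _ => ?_
  simp [corner, entry, mul_comm]

theorem ofCorner_one (n : ℕ) : ofCorner n 1 = P n := by
  ext1 x
  simp [ofCorner_apply, P_eq, Matrix.one_apply]

theorem ofCorner_mul (n : ℕ) (M N : Matrix (Fin n) (Fin n) ℂ) :
    ofCorner n M ∘L ofCorner n N = ofCorner n (M * N) := by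
  ext1 x
  have h : ∀ k : Fin n, ofCorner n N x k = ∑ l : Fin n, N k l * x l := fun k => by
    rw [ofCorner_apply, lp.coeFn_sum, Finset.sum_apply]
    simp [e_apply, Fin.val_inj]
  rw [ContinuousLinearMap.comp_apply, ofCorner_apply n M, ofCorner_apply n (M * N)]
  refine Finset.sum_congr rfl fun j _ => ?_
  congr 1
  simp only [h, Matrix.mul_apply, Finset.mul_sum, Finset.sum_mul]
  rw [Finset.sum_comm]
  simp only [mul_assoc]

/-- If `A = P_n A P_n` has a block with nonzero determinant, then `sectionInv n A` is the inverse
of `A` on the range of `P_n`. -/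
theorem sectionInv_mul (n : ℕ) (A : Ell2 →L[ℂ] Ell2) (hA : P n ∘L A ∘L P n = A)
    (hdet : (corner n A).det ≠ 0) :
    sectionInv n A ∘L A = P n ∧ A ∘L sectionInv n A = P n := by
  have h : ofCorner n (corner n A) = A := (ofCorner_corner n A).trans hA
  have hu : IsUnit (corner n A).det := isUnit_iff_ne_zero.2 hdet
  have h1 : ofCorner n (corner n A)⁻¹ ∘L ofCorner n (corner n A) = P n := by
    rw [ofCorner_mul, Matrix.nonsing_inv_mul _ hu, ofCorner_one]
  have h2 : ofCorner n (corner n A) ∘L ofCorner n (corner n A)⁻¹ = P n := by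
    rw [ofCorner_mul, Matrix.mul_nonsing_inv _ hu, ofCorner_one]
  rw [h] at h1 h2
  exact ⟨h1, h2⟩

/-- The inverse operator `T(a⁻¹)⁻¹`; it is meaningful if `a ∈ Φ(B)` and `B` is suitable. -/
def toeplitzInv {B : Type*} [NormedRing B] [NormedAlgebra ℂ B] (ι : B →L[ℂ] Linf) (a : B) :
    Ell2 →L[ℂ] Ell2 :=
  Ring.inverse (toeplitz (ι (Ring.inverse a)))

/-- The constant `G[a]`, the `(0,0)` entry of `T(a⁻¹)⁻¹`. -/
def G {B : Type*} [NormedRing B] [NormedAlgebra ℂ B] (ι : B →L[ℂ] Linf) (a : B) : ℂ :=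
  entry (toeplitzInv ι a) 0 0

/-- The finite section `A_n = P_n T(a⁻¹)⁻¹ P_n`. -/
def A {B : Type*} [NormedRing B] [NormedAlgebra ℂ B] (ι : B →L[ℂ] Linf) (n : ℕ) (a : B) :
    Ell2 →L[ℂ] Ell2 :=
  P n ∘L toeplitzInv ι a ∘L P n

end Szego

end

noncomputable section

namespace Szego

/-! ### The shift and finite sections of inverses -/

/-! Parts (i) and (ii) use only that `T = T(a⁻¹)` is invertible with constant diagonals, i.e. `S*ⁿ T
Sⁿ = T` for the shift `S`. Let `V = T⁻¹`. By `IsToeplitz.entry_inv_succ`, row operations reduce the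
block of `V` of size `n + 1` to the block of size `n` bordered by `V₀₀`, so the determinants are
powers of `V₀₀ ≠ 0`. The inverse of a finite section of `V` is the Schur complement in `T` of the
tail block, and the tail block is a shifted copy of `T`; this gives the explicit expression `kozak`.
Its correction term contains `S*ⁿ`, which tends strongly to zero, and its dependence on `T` and `V`
is controlled uniformly in `n`. Strong convergence and equicontinuity follow; the adjoints are
covered because `T*` is again Toeplitz.

For (iii), the set of `s ∈ ℂ` with `T(e^{sb})` invertible contains 0 and is open; it is also closed,
hence everything. Indeed, membership in `K` makes Hankel operators Hilbert–Schmidt, so a Toeplitz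
operator with invertible symbol has a left inverse modulo compact operators. By `coburn`, it or its
adjoint is injective, hence bounded below, and a limit of invertible operators that is bounded below
is invertible. No index theory is needed. Finally `ψ(s) = [T(e^{sb})⁻¹]₀₀` solves `ψ' = -b₀ψ`, by
`entry_inv_mul_toeplitz_mul_inv`, and `s = -1` yields `G[e^b]`. -/

theorem orthonormal_e : Orthonormal ℂ e := by
  rw [orthonormal_iff_ite]
  intro i j
  rw [inner_e, e_apply]

/-- The `n`-th power `e_k ↦ e_{k+n}` of the shift on `ℓ²`. -/
def shift (n : ℕ) : Ell2 →L[ℂ] Ell2 :=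
  ((orthonormal_e.comp (fun k => k + n)
    (add_left_injective n)).orthogonalFamily.linearIsometry).toContinuousLinearMap

/-- The `n`-th power of the backward shift on `ℓ²`. -/
def backShift (n : ℕ) : Ell2 →L[ℂ] Ell2 := ContinuousLinearMap.adjoint (shift n)

theorem shift_e (n k : ℕ) : shift n (e k) = e (k + n) := by
  simp [shift, e, OrthogonalFamily.linearIsometry_apply_single]

theorem norm_shift_le (n : ℕ) : ‖shift n‖ ≤ 1 := LinearIsometry.norm_toContinuousLinearMap_le _

theorem norm_backShift_le (n : ℕ) : ‖backShift n‖ ≤ 1 := by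
  rw [backShift, LinearIsometryEquiv.norm_map]
  exact norm_shift_le n

theorem ell2_ext {x y : Ell2} (h : ∀ k, x k = y k) : x = y := lp.ext (funext h)

theorem hasSum_e (x : Ell2) : HasSum (fun k => x k • e k) x := by
  convert lp.hasSum_single (by norm_num) x using 2 with k
  rw [e, ← lp.single_smul, smul_eq_mul, mul_one]

theorem clm_ext_e {F : Type*} [NormedAddCommGroup F] [NormedSpace ℂ F] {A B : Ell2 →L[ℂ] F}
    (h : ∀ k, A (e k) = B (e k)) : A = B := by
  ext1 x
  refine (A.hasSum (hasSum_e x)).unique ?_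
  convert B.hasSum (hasSum_e x) using 2 with k
  simp [h]

theorem backShift_apply (n : ℕ) (x : Ell2) (k : ℕ) : backShift n x k = x (k + n) := by
  rw [← inner_e, backShift, ContinuousLinearMap.adjoint_inner_right, shift_e, inner_e]

theorem backShift_shift (n : ℕ) : backShift n * shift n = 1 := by
  refine clm_ext_e fun k => ell2_ext fun i => ?_
  simp [backShift_apply, shift_e, e_apply]

theorem P_add_shift_backShift (n : ℕ) : P n + shift n * backShift n = 1 := by
  refine clm_ext_e fun k => ell2_ext fun i => ?_
  have h : backShift n (e k) = if n ≤ k then e (k - n) else 0 := by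
    refine ell2_ext fun j => ?_
    rw [backShift_apply, e_apply]
    split_ifs with h1 h2 h2
    · rw [e_apply, if_pos (by omega)]
    · omega
    · rw [e_apply, if_neg (by omega)]
    · rfl
  have h' : shift n (backShift n (e k)) = if n ≤ k then e k else 0 := by
    rw [h]
    split_ifs with h1
    · rw [shift_e, Nat.sub_add_cancel h1]
    · simp
  simp only [add_apply, mul_apply_eq_comp, h',
    lp.coeFn_add, Pi.add_apply, P_apply, one_apply_eq_self]
  split_ifs <;> simp_all [e_apply] <;> omega

theorem P_eq_one_sub (n : ℕ) : P n = 1 - shift n * backShift n :=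
  eq_sub_of_add_eq (P_add_shift_backShift n)

theorem backShift_mul_P (n : ℕ) : backShift n * P n = 0 := by
  rw [P_eq_one_sub, mul_sub, ← mul_assoc, backShift_shift, mul_one, one_mul, sub_self]

theorem P_mul_P (n : ℕ) : P n * P n = P n := by
  rw [← ofCorner_one]
  exact (ofCorner_mul n 1 1).trans (by rw [mul_one])

theorem star_P (n : ℕ) : star (P n) = P n := by
  rw [P_eq_one_sub, backShift, ← ContinuousLinearMap.star_eq_adjoint]
  simp

theorem norm_P_le (n : ℕ) : ‖P n‖ ≤ 1 := by
  have h := CStarRing.norm_star_mul_self (x := P n)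
  rw [star_P, P_mul_P] at h
  by_contra! hc
  nlinarith

theorem tendsto_P (x : Ell2) : Tendsto (fun n => P n x) atTop (𝓝 x) := by
  convert (hasSum_e x).tendsto_sum_nat using 2 with n
  rw [P_eq, Fin.sum_univ_eq_sum_range (fun k => x k • e k) n]

/-- The contraction `backShift n` annihilates `P n x`, so it only sees the tail `x - P n x`. -/
theorem tendsto_backShift (x : Ell2) : Tendsto (fun n => backShift n x) atTop (𝓝 0) := by
  have h : ∀ n, backShift n x = backShift n (x - P n x) := fun n => by
    rw [map_sub]
    have := congrArg (fun X : Ell2 →L[ℂ] Ell2 => X x) (backShift_mul_P n)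
    simp only [mul_apply_eq_comp] at this
    rw [this]; simp
  refine squeeze_zero_norm (a := fun n => ‖x - P n x‖) (fun n => ?_) ?_
  · rw [h]
    exact ((backShift n).le_opNorm _).trans
      (mul_le_of_le_one_left (norm_nonneg _) (norm_backShift_le n))
  · simpa using ((tendsto_P x).const_sub x).norm

/-- Operators with a Toeplitz matrix, i.e. with constant diagonals. -/
def IsToeplitz (T : Ell2 →L[ℂ] Ell2) : Prop := ∀ n, backShift n * T * shift n = T

theorem isToeplitz_toeplitz (a : Linf) : IsToeplitz (toeplitz a) := by
  refine fun n => clm_ext_e fun k => ell2_ext fun j => ?_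
  simp only [mul_apply_eq_comp, backShift_apply, shift_e]
  change entry _ _ _ = entry _ _ _
  rw [entry_toeplitz, entry_toeplitz]
  congr 1
  push_cast
  ring

theorem IsToeplitz.star {T : Ell2 →L[ℂ] Ell2} (hT : IsToeplitz T) : IsToeplitz (star T) := by
  intro n
  have h := congrArg Star.star (hT n)
  simpa [backShift, ← ContinuousLinearMap.star_eq_adjoint, mul_assoc] using h

/-! ### Inverses of Toeplitz operators: determinants and inverses of finite sections -/

section Sections

variable {T V : Ell2 →L[ℂ] Ell2}

/-- If `V₀₀ = 0`, then `x = V e₀` equals `S y` with `y = S* x`, and `T y = S* T S y = S* e₀ = 0`.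
Injectivity of `T` gives `y = 0`, so `x = 0`, contradicting `T x = e₀`. -/
theorem IsToeplitz.entry_inv_ne_zero (hT : IsToeplitz T) (hTV : T * V = 1) (hVT : V * T = 1) :
    entry V 0 0 ≠ 0 := by
  intro h0
  set x := V (e 0) with hx
  have hTx : T x = e 0 := by
    have := congrArg (fun X : Ell2 →L[ℂ] Ell2 => X (e 0)) hTV
    simpa using this
  have hP : P 1 x = 0 := by
    refine ell2_ext fun i => ?_
    rw [P_apply]
    split_ifs with hi
    · obtain rfl : i = 0 := by omega
      exact h0
    · rfl
  have hxs : shift 1 (backShift 1 x) = x := by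
    have := congrArg (fun X : Ell2 →L[ℂ] Ell2 => X x) (P_add_shift_backShift 1)
    simpa [hP] using this
  have h1 : T (backShift 1 x) = 0 := by
    have h2 := congrArg (fun X : Ell2 →L[ℂ] Ell2 => X (backShift 1 x)) (hT 1)
    simp only [mul_apply_eq_comp, hxs, hTx] at h2
    rw [← h2]
    refine ell2_ext fun i => ?_
    simp [backShift_apply, e_apply]
  have h2 : backShift 1 x = 0 := by
    have := congrArg (fun X : Ell2 →L[ℂ] Ell2 => X (backShift 1 x)) hVT
    simpa [h1] using this.symm
  rw [h2, map_zero] at hxs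
  rw [← hxs, map_zero] at hTx
  have := e_apply 0 0
  rw [← hTx] at this
  simp at this

/-- The Gohberg–Semencul identity for the entries of the inverse of a Toeplitz operator. -/
theorem IsToeplitz.entry_inv_succ (hT : IsToeplitz T) (hTV : T * V = 1) (hVT : V * T = 1)
    (j k : ℕ) :
    entry V (j + 1) (k + 1) = entry V j k + entry V (j + 1) 0 / entry V 0 0 * entry V 0 (k + 1) := by
  have hG := hT.entry_inv_ne_zero hTV hVT
  have hP : ∀ x, P 1 x = x 0 • e 0 := fun x => by simp [P_eq]
  have hdec : ∀ x, shift 1 (backShift 1 x) = x - x 0 • e 0 := fun x => by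
    have := congrArg (fun X : Ell2 →L[ℂ] Ell2 => X x) (P_add_shift_backShift 1)
    simp only [add_apply, mul_apply_eq_comp,
      one_apply_eq_self, hP] at this
    exact eq_sub_of_add_eq' this
  -- `T` commutes with the backward shift up to a multiple of the fixed vector `S* T e₀`. Below, `x
  -- = V e_{k+1}` and `x = V e₀` are combined so that this vector cancels.
  have hT' : ∀ x, T (backShift 1 x) = backShift 1 (T x) - x 0 • backShift 1 (T (e 0)) := fun x => by
    have := congrArg (fun X : Ell2 →L[ℂ] Ell2 => X (backShift 1 x)) (hT 1)
    simp only [mul_apply_eq_comp, hdec] at this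
    rw [← this]; simp
  have hTV' : ∀ x, T (V x) = x := fun x => congrArg (fun X : Ell2 →L[ℂ] Ell2 => X x) hTV
  have hVT' : ∀ x, V (T x) = x := fun x => congrArg (fun X : Ell2 →L[ℂ] Ell2 => X x) hVT
  have hb0 : backShift 1 (e 0) = 0 := ell2_ext fun i => by simp [backShift_apply, e_apply]
  have hbk : backShift 1 (e (k + 1)) = e k := ell2_ext fun i => by simp [backShift_apply, e_apply]
  have key : V (e k) = backShift 1 (V (e (k + 1)))
      - (entry V 0 (k + 1) / entry V 0 0) • backShift 1 (V (e 0)) := by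
    rw [← hVT' (backShift 1 (V (e (k + 1)))
      - (entry V 0 (k + 1) / entry V 0 0) • backShift 1 (V (e 0)))]
    congr 1
    rw [map_sub, map_smul, hT', hT', hTV', hTV', hb0, hbk]
    change _ = _ - entry V 0 (k + 1) • _ - _ • (0 - entry V 0 0 • _)
    rw [zero_sub, smul_neg, smul_smul, div_mul_cancel₀ _ hG]
    abel
  have := congrArg (fun x : Ell2 => x j) key
  simp only [lp.coeFn_sub, lp.coeFn_smul, Pi.sub_apply, Pi.smul_apply, backShift_apply,
    smul_eq_mul] at this
  change entry V j k = entry V (j + 1) (k + 1) - _ * entry V (j + 1) 0 at this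
  rw [this]
  ring

/-- Subtracting `V_{j+1,0} / V₀₀` times row 0 from row `j + 1` leaves zeros below `V₀₀` and, by
`entry_inv_succ`, the block of size `n` in the remaining corner. -/
theorem IsToeplitz.det_corner_inv (hT : IsToeplitz T) (hTV : T * V = 1) (hVT : V * T = 1) (n : ℕ) :
    (corner n V).det = entry V 0 0 ^ n := by
  induction n with
  | zero => simp
  | succ n ih =>
    have h : (corner (n + 1) V).det = (Matrix.of (Fin.cons (fun k : Fin (n + 1) => entry V 0 k)
        fun j => Fin.cons 0 fun k => corner n V j k) : Matrix (Fin (n + 1)) (Fin (n + 1)) ℂ).det := by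
      refine Matrix.det_eq_of_forall_row_eq_smul_add_const
        (Fin.cons 0 fun j : Fin n => entry V (j + 1) 0 / entry V 0 0) 0 (by simp) fun i j => ?_
      refine Fin.cases ?_ (fun i => ?_) i
      · simp [corner]
      · refine Fin.cases ?_ (fun j => ?_) j
        · simp [corner, hT.entry_inv_ne_zero hTV hVT]
        · simp [corner, hT.entry_inv_succ hTV hVT]
    rw [h, Matrix.det_succ_column_zero, Fin.sum_univ_succ]
    have h2 : (Matrix.of (Fin.cons (fun k : Fin (n + 1) => entry V 0 k)
        fun j => Fin.cons 0 fun k => corner n V j k) :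
        Matrix (Fin (n + 1)) (Fin (n + 1)) ℂ).submatrix (Fin.succAbove 0) Fin.succ
        = corner n V := by
      ext i j; simp
    rw [h2, ih, pow_succ']
    simp

/-- Kozak's formula for the inverse of the finite section of `V = T⁻¹`. -/
def kozak (T V : Ell2 →L[ℂ] Ell2) (n : ℕ) : Ell2 →L[ℂ] Ell2 :=
  P n * T * P n - P n * T * shift n * V * backShift n * T * P n

/-- The inverse of a block of `V = T⁻¹` is the Schur complement in `T` of the complementary block.
That block is compressed to the range of `Sⁿ`, where the Toeplitz property makes `Sⁿ V S*ⁿ` its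
inverse. -/
theorem IsToeplitz.kozak_mul (hT : IsToeplitz T) (hTV : T * V = 1) (hVT : V * T = 1) (n : ℕ) :
    kozak T V n * (P n * V * P n) = P n := by
  have h1 : T * P n * V = 1 - T * (shift n * backShift n) * V := by
    rw [P_eq_one_sub, mul_sub, sub_mul, mul_one, hTV]
  have h2 : backShift n * T * shift n = T := hT n
  have h3 := backShift_mul_P n
  calc kozak T V n * (P n * V * P n)
      = P n * (T * (P n * P n) * V) * P n
        - P n * T * shift n * V * backShift n * (T * (P n * P n) * V) * P n := by
        simp only [kozak, sub_mul, mul_assoc]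
    _ = P n - P n * T * shift n * backShift n * V * P n
        - (P n * T * shift n * V * (backShift n * P n)
          - P n * T * shift n * V * (backShift n * T * shift n) * backShift n * V * P n) := by
        rw [P_mul_P, h1]
        simp only [mul_sub, sub_mul, mul_one, mul_assoc, P_mul_P]
    _ = P n - P n * T * shift n * backShift n * V * P n
        - (0 - P n * T * shift n * (V * T) * backShift n * V * P n) := by
        rw [h2, h3, mul_zero]
        simp only [mul_assoc]
    _ = P n := by
        rw [hVT, mul_one]
        abel

theorem corner_P_mul_mul_P (n : ℕ) (A : Ell2 →L[ℂ] Ell2) :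
    corner n (P n * A * P n) = corner n A := by
  ext j k
  have : P n (e k) = e k := ell2_ext fun i => by
    rw [P_apply, e_apply]
    split_ifs <;> first | rfl | (have := k.2; omega)
  simp [corner, entry, this, P_apply]

theorem IsToeplitz.sectionInv_eq_kozak (hT : IsToeplitz T) (hTV : T * V = 1) (hVT : V * T = 1)
    (n : ℕ) : sectionInv n (P n * V * P n) = kozak T V n := by
  have hd : (corner n (P n * V * P n)).det ≠ 0 := by
    rw [corner_P_mul_mul_P, hT.det_corner_inv hTV hVT]
    exact pow_ne_zero _ (hT.entry_inv_ne_zero hTV hVT)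
  have h := (sectionInv_mul n (P n * V * P n) (by
    change P n * (P n * V * P n * P n) = _
    simp only [mul_assoc, P_mul_P]
    simp only [← mul_assoc, P_mul_P]) hd).2
  change (P n * V * P n) * sectionInv n (P n * V * P n) = P n at h
  have hP : P n * sectionInv n (P n * V * P n) = sectionInv n (P n * V * P n) := by
    rw [← ofCorner_one, sectionInv]
    exact (ofCorner_mul _ _ _).trans (by rw [one_mul])
  calc sectionInv n (P n * V * P n)
      = kozak T V n * (P n * V * P n) * sectionInv n (P n * V * P n) := by
        rw [hT.kozak_mul hTV hVT n, hP]
    _ = kozak T V n * P n := by rw [mul_assoc, h]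
    _ = kozak T V n := by simp only [kozak, sub_mul, mul_assoc, P_mul_P]

/-- The first term tends strongly to `T`; in the second, `S*ⁿ T P_n x` tends to zero and all factors
to its left are uniformly bounded. -/
theorem tendsto_kozak (T V : Ell2 →L[ℂ] Ell2) (x : Ell2) :
    Tendsto (fun n => kozak T V n x) atTop (𝓝 (T x)) := by
  have bound : ∀ (A : ℕ → Ell2 →L[ℂ] Ell2), (∀ n, ‖A n‖ ≤ 1) → ∀ (u : ℕ → Ell2),
      Tendsto u atTop (𝓝 0) → Tendsto (fun n => A n (u n)) atTop (𝓝 0) := by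
    intro A hA u hu
    refine squeeze_zero_norm (fun n => ?_) (by simpa using hu.norm)
    exact ((A n).le_opNorm _).trans (mul_le_of_le_one_left (norm_nonneg _) (hA n))
  have hp : Tendsto (fun n => T (P n x)) atTop (𝓝 (T x)) := (T.continuous.tendsto _).comp (tendsto_P x)
  have hd : Tendsto (fun n => T (P n x) - T x) atTop (𝓝 0) := by
    simpa using hp.sub_const (T x)
  have h1 : Tendsto (fun n => P n (T (P n x))) atTop (𝓝 (T x)) := by
    have := (bound P norm_P_le _ hd).add (tendsto_P (T x))
    simpa using this
  have h2 : Tendsto (fun n => backShift n (T (P n x))) atTop (𝓝 0) := by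
    have := (bound backShift norm_backShift_le _ hd).add (tendsto_backShift (T x))
    simpa using this
  have h3 : Tendsto (fun n => V (backShift n (T (P n x)))) atTop (𝓝 0) := by
    simpa [Function.comp_def] using (V.continuous.tendsto _).comp h2
  have h4 := bound shift norm_shift_le _ h3
  have h5 : Tendsto (fun n => T (shift n (V (backShift n (T (P n x)))))) atTop (𝓝 0) := by
    simpa [Function.comp_def] using (T.continuous.tendsto _).comp h4
  have h6 := h1.sub (bound P norm_P_le _ h5)
  simpa [kozak] using h6

/-- The bound is free of `n`: the projections and shifts are contractions, and the triple product is
telescoped one factor at a time. -/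
theorem norm_kozak_sub_le (T V T' V' : Ell2 →L[ℂ] Ell2) (n : ℕ) :
    ‖kozak T V n - kozak T' V' n‖ ≤ ‖T - T'‖ + (‖T - T'‖ * ‖V‖ * ‖T‖
      + ‖T'‖ * ‖V - V'‖ * ‖T‖ + ‖T'‖ * ‖V'‖ * ‖T - T'‖) := by
  have hp := norm_P_le n
  have hs := norm_shift_le n
  have hb := norm_backShift_le n
  have key : ∀ X Y Z : Ell2 →L[ℂ] Ell2,
      ‖P n * X * shift n * Y * backShift n * Z * P n‖ ≤ ‖X‖ * ‖Y‖ * ‖Z‖ := by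
    intro X Y Z
    calc _ ≤ ‖P n‖ * ‖X‖ * ‖shift n‖ * ‖Y‖ * ‖backShift n‖ * ‖Z‖ * ‖P n‖ := by
          iterate 6 refine (norm_mul_le _ _).trans (mul_le_mul_of_nonneg_right ?_ (norm_nonneg _))
          exact le_rfl
      _ ≤ 1 * ‖X‖ * 1 * ‖Y‖ * 1 * ‖Z‖ * 1 := by gcongr
      _ = _ := by ring
  have key1 : ∀ X : Ell2 →L[ℂ] Ell2, ‖P n * X * P n‖ ≤ ‖X‖ := by
    intro X
    calc _ ≤ ‖P n‖ * ‖X‖ * ‖P n‖ := by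
          iterate 2 refine (norm_mul_le _ _).trans (mul_le_mul_of_nonneg_right ?_ (norm_nonneg _))
          exact le_rfl
      _ ≤ 1 * ‖X‖ * 1 := by gcongr
      _ = _ := by ring
  have hdec : kozak T V n - kozak T' V' n = P n * (T - T') * P n
      - (P n * (T - T') * shift n * V * backShift n * T * P n
        + P n * T' * shift n * (V - V') * backShift n * T * P n
        + P n * T' * shift n * V' * backShift n * (T - T') * P n) := by
    simp only [kozak]
    noncomm_ring
  rw [hdec]
  refine (norm_sub_le _ _).trans (add_le_add (key1 _) ?_)
  refine (norm_add_le _ _).trans (add_le_add ?_ (key _ _ _))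
  exact (norm_add_le _ _).trans (add_le_add (key _ _ _) (key _ _ _))

end Sections

/-! ### Fourier coefficients of integrable functions -/

/-- The functional `g ↦ ∫ g h` is continuous in the sup norm and vanishes on the trigonometric
polynomials, which are dense. -/
theorem integral_mul_eq_zero_of_fourierCoeff {h : T → ℂ} (hh : Integrable h haarAddCircle)
    (h0 : ∀ n, fourierCoeff h n = 0) (g : C(T, ℂ)) : ∫ x, g x * h x ∂haarAddCircle = 0 := by
  have hint : ∀ g : C(T, ℂ), Integrable (fun x => g x * h x) haarAddCircle := fun g =>
    hh.bdd_mul (c := ‖g‖) g.continuous.aestronglyMeasurable (Eventually.of_forall g.norm_coe_le_norm)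
  let L : C(T, ℂ) →L[ℂ] ℂ := LinearMap.mkContinuous
    { toFun := fun g => ∫ x, g x * h x ∂haarAddCircle
      map_add' := fun g g' => by
        rw [← integral_add (hint g) (hint g')]
        simp [add_mul]
      map_smul' := fun r g => by
        rw [RingHom.id_apply, smul_eq_mul, ← integral_const_mul]
        simp [mul_assoc] } (∫ x, ‖h x‖ ∂haarAddCircle) (fun g => by
      refine (norm_integral_le_integral_norm _).trans ?_
      rw [mul_comm (∫ x, ‖h x‖ ∂haarAddCircle), ← integral_const_mul]
      refine integral_mono (hint g).norm (hh.norm.const_mul _) fun x => ?_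
      simp only [norm_mul]
      exact mul_le_mul_of_nonneg_right (g.norm_coe_le_norm x) (norm_nonneg _))
  have hker : (⊤ : Submodule ℂ C(T, ℂ)) ≤ L.ker := by
    rw [← span_fourier_closure_eq_top]
    refine Submodule.topologicalClosure_minimal _ (Submodule.span_le.2 ?_) L.isClosed_ker
    rintro _ ⟨n, rfl⟩
    have := h0 (-n)
    rw [fourierCoeff, neg_neg] at this
    exact this
  exact hker (Submodule.mem_top : g ∈ _)

/-- Uniqueness is needed in `L¹`, since it is applied to products of two `L²` functions. Indicators
of closed sets are bounded pointwise limits of continuous functions, so `h` integrates to zero over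
every closed set. -/
theorem ae_eq_zero_of_fourierCoeff {h : T → ℂ} (hh : Integrable h haarAddCircle)
    (h0 : ∀ n, fourierCoeff h n = 0) : h =ᵐ[haarAddCircle] 0 := by
  refine ae_eq_zero_of_forall_setIntegral_isClosed_eq_zero hh fun s hs => ?_
  have hδ : ∀ n : ℕ, 0 < 1 / ((n : ℝ) + 1) := fun n => Nat.one_div_pos_of_nat
  let φ : ℕ → C(T, ℂ) := fun n => ⟨fun x => ((thickenedIndicator (hδ n) s x : ℝ) : ℂ), by fun_prop⟩
  have hlim : Tendsto (fun n => ∫ x, φ n x * h x ∂haarAddCircle) atTop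
      (𝓝 (∫ x, s.indicator h x ∂haarAddCircle)) := by
    refine tendsto_integral_of_dominated_convergence (fun x => ‖h x‖)
      (fun n => (φ n).continuous.aestronglyMeasurable.mul hh.1) hh.norm
      (fun n => Eventually.of_forall fun x => ?_) (Eventually.of_forall fun x => ?_)
    · rw [norm_mul]
      refine mul_le_of_le_one_left (norm_nonneg _) ?_
      simpa [φ] using thickenedIndicator_le_one (hδ n) s x
    · have h1 := (tendsto_pi_nhds.1 (thickenedIndicator_tendsto_indicator_closure hδ
        tendsto_one_div_add_atTop_nhds_zero_nat s)) x
      have h2 := ((Complex.continuous_ofReal.comp NNReal.continuous_coe).tendsto _).comp h1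
      have h3 := h2.mul_const (h x)
      rw [hs.closure_eq] at h3
      have h4 : s.indicator h x = (Complex.ofReal ∘ NNReal.toReal)
          (s.indicator (fun _ => (1 : NNReal)) x) * h x := by
        by_cases hx : x ∈ s <;> simp [hx]
      rw [h4]
      exact h3
  rw [← integral_indicator hs.measurableSet]
  refine tendsto_nhds_unique hlim ?_
  simp [integral_mul_eq_zero_of_fourierCoeff hh h0]

theorem ae_eq_const_of_fourierCoeff {h : T → ℂ} (hh : Integrable h haarAddCircle)
    (h0 : ∀ n, n ≠ 0 → fourierCoeff h n = 0) :
    h =ᵐ[haarAddCircle] fun _ => fourierCoeff h 0 := by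
  set c := fourierCoeff h 0 with hc
  have hconst : ∀ n, fourierCoeff (fun _ : T => c) n = if n = 0 then c else 0 := fun n => by
    have := fourierCoeff_fourier (T := 2 * Real.pi) 0
    have h1 : (fun _ : T => c) = c • (fun x => fourier 0 x : T → ℂ) := by ext; simp
    rw [h1, fourierCoeff.const_smul]
    rw [show (fun x => fourier 0 x : T → ℂ) = ⇑(fourier (T := 2 * Real.pi) 0) from rfl, this]
    simp [Pi.single_apply]
  have hadd := fourierCoeff.add hh (integrable_const (μ := haarAddCircle) (-c) : Integrable
    (fun _ : T => -c) haarAddCircle)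
  have hneg : (fun _ : T => -c) = (-1 : ℂ) • fun _ : T => c := by ext; simp
  have h1 : (h + fun _ => -c) =ᵐ[haarAddCircle] 0 := by
    refine ae_eq_zero_of_fourierCoeff (hh.add (integrable_const _)) fun n => ?_
    rw [hadd, hneg, Pi.add_apply, fourierCoeff.const_smul, hconst]
    split_ifs with hn
    · subst hn; simp [← hc]
    · simp [h0 n hn]
  filter_upwards [h1] with x hx
  simpa [add_neg_eq_zero] using hx

/-! ### Multiplication operators on `L²` -/

theorem coeFn_mulOp (a : Linf) (f : L2) :
    (mulOp a f : T → ℂ) =ᵐ[haarAddCircle] fun x => a x * f x :=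
  (ContinuousLinearMap.mul ℂ ℂ).coeFn_holder (r := 2) a f

theorem mulOp_congr_mul {a b d : Linf} (h : (d : T → ℂ) =ᵐ[haarAddCircle] fun x => a x * b x) :
    mulOp d = mulOp a * mulOp b := by
  ext1 f
  refine Lp.ext ?_
  filter_upwards [h, coeFn_mulOp d f, coeFn_mulOp b f, coeFn_mulOp a (mulOp b f)] with x h1 h2 h3 h4
  rw [h2, mul_apply_eq_comp, h4, h3, h1, mul_assoc]

theorem mulOp_comm (a b : Linf) (f : L2) : mulOp a (mulOp b f) = mulOp b (mulOp a f) := by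
  refine Lp.ext ?_
  filter_upwards [coeFn_mulOp a f, coeFn_mulOp b f, coeFn_mulOp a (mulOp b f),
    coeFn_mulOp b (mulOp a f)] with x h1 h2 h3 h4
  rw [h3, h4, h1, h2]
  ring

theorem inner_mulOp (a : Linf) (f g : L2) :
    inner ℂ (mulOp a f) g = ∫ x, conj (a x) * (conj (f x) * g x) ∂haarAddCircle := by
  rw [L2.inner_def]
  refine integral_congr_ae ?_
  filter_upwards [coeFn_mulOp a f] with x hx
  rw [RCLike.inner_apply, hx, map_mul]
  ring

theorem inner_mulOp_right (a : Linf) (f g : L2) :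
    inner ℂ f (mulOp a g) = ∫ x, a x * (conj (f x) * g x) ∂haarAddCircle := by
  rw [L2.inner_def]
  refine integral_congr_ae ?_
  filter_upwards [coeFn_mulOp a g] with x hx
  rw [RCLike.inner_apply, hx]
  ring

theorem adjoint_mulOp (a : Linf) : ContinuousLinearMap.adjoint (mulOp a) = mulOp (star a) := by
  ext1 f
  refine ext_inner_right ℂ fun g => ?_
  rw [ContinuousLinearMap.adjoint_inner_left, inner_mulOp_right, inner_mulOp]
  refine integral_congr_ae ?_
  filter_upwards [Lp.coeFn_star a] with x hx
  rw [hx]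
  simp

theorem integrable_conj_mul (f g : L2) :
    Integrable (fun x => conj (f x) * g x) haarAddCircle := by
  have := L2.integrable_inner (𝕜 := ℂ) f g
  simpa [RCLike.inner_apply, mul_comm] using this

theorem fourierCoeff_eq_inner (f : L2) (n : ℤ) :
    fourierCoeff f n = inner ℂ (fourierLp 2 n : L2) f := by
  rw [← fourierBasis_repr, HilbertBasis.repr_apply_apply, coe_fourierBasis]

theorem L2_ext_fourierCoeff {f g : L2} (h : ∀ n, fourierCoeff f n = fourierCoeff g n) : f = g := by
  refine fourierBasis.repr.injective (lp.ext (funext fun n => ?_))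
  rw [fourierBasis_repr, fourierBasis_repr, h]

/-- Multiplication by `exp(inx)` on `L²`. -/
def modOp (n : ℤ) : L2 →L[ℂ] L2 := mulOp (fourierLp ∞ n)

theorem coeFn_modOp (n : ℤ) (f : L2) :
    (modOp n f : T → ℂ) =ᵐ[haarAddCircle] fun x => fourier n x * f x := by
  filter_upwards [coeFn_mulOp (fourierLp ∞ n) f, coeFn_fourierLp (T := 2 * Real.pi) ∞ n] with x h1 h2
  rw [modOp, h1, h2]

theorem fourierCoeff_modOp (n k : ℤ) (f : L2) :
    fourierCoeff (modOp n f) k = fourierCoeff f (k - n) := by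
  rw [fourierCoeff, fourierCoeff]
  refine integral_congr_ae ?_
  filter_upwards [coeFn_modOp n f] with x hx
  rw [hx, neg_sub, sub_eq_add_neg, fourier_add]
  simp only [smul_eq_mul]
  ring

theorem modOp_modOp (m n : ℤ) (f : L2) : modOp m (modOp n f) = modOp (m + n) f :=
  L2_ext_fourierCoeff fun k => by
    simp only [fourierCoeff_modOp]
    congr 1
    ring

theorem fourierCoeff_conj_mul (f g : L2) (n : ℤ) :
    fourierCoeff (fun x => conj (f x) * g x) n = inner ℂ (modOp n f) g := by
  rw [modOp, inner_mulOp, fourierCoeff]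
  refine integral_congr_ae ?_
  filter_upwards [coeFn_fourierLp (T := 2 * Real.pi) ∞ n] with x hx
  rw [hx, fourier_neg, smul_eq_mul]

theorem hasSum_fourierCoeff_conj_mul (f g : L2) (n : ℤ) :
    HasSum (fun k => conj (fourierCoeff f (k - n)) * fourierCoeff g k)
      (fourierCoeff (fun x => conj (f x) * g x) n) := by
  rw [fourierCoeff_conj_mul]
  have h := fourierBasis.hasSum_inner_mul_inner (modOp n f) g
  have hk : ∀ k, conj (fourierCoeff f (k - n)) * fourierCoeff g k =
      inner ℂ (modOp n f) (fourierBasis k) * inner ℂ (fourierBasis k) g := fun k => by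
    rw [coe_fourierBasis, ← inner_conj_symm, ← fourierCoeff_eq_inner, ← fourierCoeff_eq_inner,
      fourierCoeff_modOp]
  simp only [hk]
  exact h

/-- Every term of the Parseval sum vanishes; this turns information on the supports of the
coefficients of `f` and `g` into information on those of `f̄ g`. -/
theorem fourierCoeff_conj_mul_eq_zero {f g : L2} {n : ℤ}
    (h : ∀ k, fourierCoeff f (k - n) = 0 ∨ fourierCoeff g k = 0) :
    fourierCoeff (fun x => conj (f x) * g x) n = 0 := by
  refine (hasSum_fourierCoeff_conj_mul f g n).unique ?_
  convert hasSum_zero using 2 with k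
  rcases h k with h | h <;> simp [h]

theorem fourierCoeff_conj_mul_zero {f g : L2}
    (h : ∀ k, k ≠ 0 → fourierCoeff f k = 0 ∨ fourierCoeff g k = 0) :
    fourierCoeff (fun x => conj (f x) * g x) 0 = conj (fourierCoeff f 0) * fourierCoeff g 0 := by
  have := hasSum_fourierCoeff_conj_mul f g 0
  simp only [sub_zero] at this
  refine this.unique (hasSum_single 0 fun k hk => ?_)
  rcases h k hk with h | h <;> simp [h]

theorem fourierCoeff_conj_mul_neg (f g : L2) (n : ℤ) :
    fourierCoeff (fun x => conj (f x) * g x) (-n) =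
      conj (fourierCoeff (fun x => conj (g x) * f x) n) := by
  rw [fourierCoeff, fourierCoeff, ← integral_conj]
  refine integral_congr_ae (Eventually.of_forall fun x => ?_)
  simp only [smul_eq_mul, map_mul, ← fourier_neg, Complex.conj_conj]
  ring

/-! ### The Hardy space -/

/-- The projection of `L²` onto the Hardy space, as a map to `ℓ²`. -/
def hardyProj : L2 →L[ℂ] Ell2 := ContinuousLinearMap.adjoint hardyEmb.toContinuousLinearMap

theorem hardyProj_apply (f : L2) (k : ℕ) : hardyProj f k = fourierCoeff f k := by
  rw [← inner_e, hardyProj, ContinuousLinearMap.adjoint_inner_right,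
    LinearIsometry.coe_toContinuousLinearMap, hardyEmb_e, fourierCoeff_eq_inner]

theorem toeplitz_apply (a : Linf) (x : Ell2) :
    toeplitz a x = hardyProj (mulOp a (hardyEmb x)) := rfl

theorem star_toeplitz (a : Linf) : star (toeplitz a) = toeplitz (star a) := by
  rw [toeplitz, toeplitz, ContinuousLinearMap.star_eq_adjoint, ContinuousLinearMap.adjoint_comp,
    ContinuousLinearMap.adjoint_comp, ContinuousLinearMap.adjoint_adjoint, adjoint_mulOp]
  rfl

theorem fourierCoeff_hardyEmb (x : Ell2) (k : ℕ) : fourierCoeff (hardyEmb x) k = x k := by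
  rw [fourierCoeff_eq_inner, ← hardyEmb_e, LinearIsometry.inner_map_map, inner_e]

theorem fourierCoeff_hardyEmb_neg (x : Ell2) {n : ℤ} (hn : n < 0) :
    fourierCoeff (hardyEmb x) n = 0 := by
  have h : hardyProj (fourierLp 2 n : L2) = 0 := by
    refine ell2_ext fun k => ?_
    rw [hardyProj_apply, fourierCoeff_eq_inner,
      orthonormal_iff_ite.1 (orthonormal_fourier (T := 2 * Real.pi)), if_neg (by omega)]
    rfl
  rw [fourierCoeff_eq_inner, ← LinearIsometry.coe_toContinuousLinearMap,
    ← ContinuousLinearMap.adjoint_inner_left]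
  change inner ℂ (hardyProj _) x = 0
  rw [h, inner_zero_left]

theorem exists_lowest_fourierCoeff {f : L2} (hf : ∀ n < 0, fourierCoeff f n = 0) (hne : f ≠ 0) :
    ∃ m, fourierCoeff f m ≠ 0 ∧ ∀ k < m, fourierCoeff f k = 0 := by
  have hex : ∃ m : ℕ, fourierCoeff f m ≠ 0 := by
    by_contra! hc
    refine hne (L2_ext_fourierCoeff fun n => ?_)
    have h0 : fourierCoeff ((0 : L2) : T → ℂ) n = 0 := by
      rw [fourierCoeff_eq_inner, inner_zero_right]
    rw [h0]
    rcases lt_or_ge n 0 with hn | hn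
    · exact hf n hn
    · lift n to ℕ using hn
      exact hc n
  classical
  refine ⟨Nat.find hex, Nat.find_spec hex, fun k hk => ?_⟩
  rcases lt_or_ge k 0 with hn | hn
  · exact hf k hn
  · lift k to ℕ using hn
    by_contra hc
    exact Nat.find_min hex (by exact_mod_cast hk) hc

/-- The closed subspace of `L²` spanned by the functions `exp(inx) f`, `n ≥ 1`. -/
def shiftSpan (f : L2) : Submodule ℂ L2 :=
  (Submodule.span ℂ (Set.range fun k : ℕ => modOp (k + 1) f)).topologicalClosure

theorem isClosed_shiftSpan (f : L2) : IsClosed (shiftSpan f : Set L2) :=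
  Submodule.isClosed_topologicalClosure _

theorem modOp_mem_shiftSpan (f : L2) (k : ℕ) : modOp (k + 1) f ∈ shiftSpan f :=
  Submodule.le_topologicalClosure _ (Submodule.subset_span ⟨k, rfl⟩)

theorem shiftSpan_le {f : L2} {K : Submodule ℂ L2} (hK : IsClosed (K : Set L2))
    (h : ∀ k : ℕ, modOp (k + 1) f ∈ K) : shiftSpan f ≤ K :=
  Submodule.topologicalClosure_minimal _
    (Submodule.span_le.2 (by rintro _ ⟨k, rfl⟩; exact h k)) hK

theorem eq_zero_of_mem_shiftSpan {F : Type*} [NormedAddCommGroup F] [NormedSpace ℂ F] {f : L2}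
    (A : L2 →L[ℂ] F) (h : ∀ k : ℕ, A (modOp (k + 1) f) = 0) {u : L2} (hu : u ∈ shiftSpan f) :
    A u = 0 :=
  LinearMap.mem_ker.1 (shiftSpan_le (K := A.ker) A.isClosed_ker (fun k => LinearMap.mem_ker.2 (h k)) hu)

theorem modOp_mem_of_mem_shiftSpan {f u : L2} (hu : u ∈ shiftSpan f) (n : ℕ) :
    modOp (n + 1) u ∈ shiftSpan f := by
  have h : shiftSpan f ≤ (shiftSpan f).comap (modOp (n + 1)).toLinearMap := by
    refine shiftSpan_le ((isClosed_shiftSpan f).preimage (modOp (n + 1)).continuous) fun k => ?_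
    rw [Submodule.mem_comap, ContinuousLinearMap.coe_coe, modOp_modOp]
    have h : ((n : ℤ) + 1) + (k + 1) = ((n + k + 1 : ℕ) : ℤ) + 1 := by push_cast; ring
    rw [h]
    exact modOp_mem_shiftSpan f _
  exact Submodule.mem_comap.1 (h hu)

/-- Take `q` to be the component of `f` orthogonal to `shiftSpan f`. Then `exp(inx) q` lies in
`shiftSpan f` for `n ≥ 1`, hence is orthogonal to `q`, and any multiplier that kills `f` kills
`shiftSpan f` and so `q`. -/
theorem exists_wandering {f : L2} {m : ℤ} (hm : fourierCoeff f m ≠ 0)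
    (hlt : ∀ k < m, fourierCoeff f k = 0) :
    ∃ q : L2, q ≠ 0 ∧ (∀ n : ℕ, inner ℂ (modOp (n + 1) q) q = 0) ∧
      ∀ χ : Linf, mulOp χ f = 0 → mulOp χ q = 0 := by
  have : CompleteSpace (shiftSpan f) := (isClosed_shiftSpan f).completeSpace_coe
  have hpN : (shiftSpan f).starProjection f ∈ shiftSpan f :=
    Submodule.starProjection_apply_mem _ _
  have hqN := Submodule.sub_starProjection_mem_orthogonal (K := shiftSpan f) f
  generalize (shiftSpan f).starProjection f = p at hpN hqN
  refine ⟨f - p, fun h0 => ?_, fun n => ?_, fun χ hχ => ?_⟩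
  -- All elements of `shiftSpan f` have vanishing `m`-th coefficient, so `f` is not among them.
  · have h1 : innerSL ℂ (fourierLp 2 m : L2) p = 0 := by
      refine eq_zero_of_mem_shiftSpan _ (fun k => ?_) hpN
      rw [innerSL_apply_apply, ← fourierCoeff_eq_inner, fourierCoeff_modOp]
      exact hlt _ (by omega)
    rw [innerSL_apply_apply, ← sub_eq_zero.1 h0, ← fourierCoeff_eq_inner] at h1
    exact hm h1
  · refine (Submodule.mem_orthogonal _ _).1 hqN _ ?_
    rw [map_sub]
    exact Submodule.sub_mem _ (modOp_mem_shiftSpan f n) (modOp_mem_of_mem_shiftSpan hpN n)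
  · have h1 : mulOp χ p = 0 := by
      refine eq_zero_of_mem_shiftSpan _ (fun k => ?_) hpN
      rw [modOp, mulOp_comm, hχ, map_zero]
    rw [map_sub, hχ, h1, sub_zero]

/-- The orthogonality relations and their conjugates say that `|q|²` has no Fourier coefficients
except the one at 0; it is a nonzero constant. -/
theorem ae_ne_zero_of_wandering {q : L2} (hq : q ≠ 0)
    (h : ∀ n : ℕ, inner ℂ (modOp (n + 1) q) q = 0) :
    ∀ᵐ x ∂(haarAddCircle : Measure T), q x ≠ 0 := by
  have hpos : ∀ n : ℤ, 0 < n → fourierCoeff (fun x => conj (q x) * q x) n = 0 := fun n hn => by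
    obtain ⟨k, rfl⟩ : ∃ k : ℕ, n = k + 1 := ⟨(n - 1).toNat, by omega⟩
    rw [fourierCoeff_conj_mul, h]
  have hc := ae_eq_const_of_fourierCoeff (integrable_conj_mul q q) fun n hn => by
    rcases lt_or_gt_of_ne hn with h | h
    · have := fourierCoeff_conj_mul_neg q q (-n)
      rwa [neg_neg, hpos (-n) (by omega), map_zero] at this
    · exact hpos n h
  have hc0 : fourierCoeff (fun x => conj (q x) * q x) 0 ≠ 0 := by
    have : modOp 0 q = q := L2_ext_fourierCoeff fun k => by rw [fourierCoeff_modOp, sub_zero]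
    rw [fourierCoeff_conj_mul, this]
    exact inner_self_ne_zero.2 hq
  filter_upwards [hc] with x hx h0
  rw [h0, mul_zero] at hx
  exact hc0 hx.symm

/-- The theorem of F. and M. Riesz: a nonzero function of the Hardy space `H²` vanishes only on a
null set. -/
theorem ae_ne_zero_of_hardy {f : L2} (hf : ∀ n < 0, fourierCoeff f n = 0) (hne : f ≠ 0) :
    ∀ᵐ x ∂(haarAddCircle : Measure T), f x ≠ 0 := by
  obtain ⟨m, hm, hlt⟩ := exists_lowest_fourierCoeff hf hne
  obtain ⟨q, hq, hw, hann⟩ := exists_wandering hm hlt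
  have hmeas : MeasurableSet {x | f x = 0} :=
    (Lp.stronglyMeasurable f).measurable (measurableSet_singleton 0)
  obtain ⟨χ, hχ⟩ : ∃ χ : Linf, (χ : T → ℂ) =ᵐ[haarAddCircle] {x | f x = 0}.indicator fun _ => 1 :=
    ⟨indicatorConstLp ∞ hmeas (measure_ne_top _ _) 1, indicatorConstLp_coeFn⟩
  -- The indicator of the zero set of `f` annihilates `f`, hence also `q`, which vanishes almost
  -- nowhere.
  have hχf : mulOp χ f = 0 := by
    refine Lp.ext ?_
    filter_upwards [coeFn_mulOp χ f, hχ, Lp.coeFn_zero ℂ 2 (haarAddCircle : Measure T)]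
      with x h1 h2 h3
    rw [h1, h2, h3]
    by_cases hx : f x = 0 <;> simp [hx]
  have h0 := Lp.coeFn_zero ℂ 2 (haarAddCircle : Measure T)
  rw [← hann χ hχf] at h0
  filter_upwards [h0, coeFn_mulOp χ q, hχ, ae_ne_zero_of_wandering hq hw] with x h1 h2 h3 h4 hx
  rw [h2, h3] at h1
  exact h4 (by simpa [hx] using h1)

/-- Coburn's lemma: for a symbol that vanishes only on a null set, the Toeplitz operator or its
adjoint is injective. -/
theorem coburn {c : Linf} (hc : ∀ᵐ x ∂(haarAddCircle : Measure T), c x ≠ 0) :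
    (∀ x, toeplitz c x = 0 → x = 0) ∨ ∀ y, star (toeplitz c) y = 0 → y = 0 := by
  by_contra! hcon
  obtain ⟨⟨x, hx, hx0⟩, y, hy, hy0⟩ := hcon
  set f := hardyEmb x with hf
  set g := hardyEmb y with hg
  have hf0 : f ≠ 0 := fun h => hx0 (hardyEmb.injective (by rw [map_zero]; exact h))
  have hg0 : g ≠ 0 := fun h => hy0 (hardyEmb.injective (by rw [map_zero]; exact h))
  have hfn : ∀ n < 0, fourierCoeff f n = 0 := fun n hn => fourierCoeff_hardyEmb_neg x hn
  have hgn : ∀ n < 0, fourierCoeff g n = 0 := fun n hn => fourierCoeff_hardyEmb_neg y hn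
  rw [star_toeplitz] at hy
  have hu : ∀ n, 0 ≤ n → fourierCoeff (mulOp c f) n = 0 := fun n hn => by
    lift n to ℕ using hn
    rw [← hardyProj_apply, hf, ← toeplitz_apply, hx]
    rfl
  have hw : ∀ n, 0 ≤ n → fourierCoeff (mulOp (star c) g) n = 0 := fun n hn => by
    lift n to ℕ using hn
    rw [← hardyProj_apply, hg, ← toeplitz_apply, hy]
    rfl
  have heq : (fun x => conj (g x) * mulOp c f x) =ᵐ[haarAddCircle]
      fun x => conj (mulOp (star c) g x) * f x := by
    filter_upwards [coeFn_mulOp c f, coeFn_mulOp (star c) g, Lp.coeFn_star c] with x h1 h2 h3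
    rw [h1, h2, h3]
    simp
    ring
  -- `ḡ·(cf)` has only negative frequencies, while the same function written as `conj(c̄g)·f` has
  -- only positive ones.
  have hz := ae_eq_zero_of_fourierCoeff (integrable_conj_mul g (mulOp c f)) fun n => by
    rcases le_total 0 n with hn | hn
    · refine fourierCoeff_conj_mul_eq_zero fun k => ?_
      rcases lt_or_ge k 0 with hk | hk
      · exact Or.inl (hgn _ (by omega))
      · exact Or.inr (hu _ hk)
    · rw [fourierCoeff_congr_ae heq]
      refine fourierCoeff_conj_mul_eq_zero fun k => ?_
      rcases lt_or_ge k 0 with hk | hk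
      · exact Or.inr (hfn _ hk)
      · exact Or.inl (hw _ (by omega))
  have hfalse : ∀ᵐ x ∂(haarAddCircle : Measure T), False := by
    filter_upwards [hz, hc, ae_ne_zero_of_hardy hfn hf0, ae_ne_zero_of_hardy hgn hg0,
      coeFn_mulOp c f] with x h1 h2 h3 h4 h5
    rw [h5] at h1
    simp_all
  exact hfalse.exists.elim fun _ h => h

/-- For an invertible `T(c)` the product `T(c)⁻¹ T(bc) T(c)⁻¹`, which is up to sign a derivative of
the inverse, has the entry `[T(c)⁻¹]₀₀ b₀` in its upper-left corner. -/
theorem entry_inv_mul_toeplitz_mul_inv {b c d : Linf} {V : Ell2 →L[ℂ] Ell2}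
    (hd : (d : T → ℂ) =ᵐ[haarAddCircle] fun x => b x * c x)
    (hTV : toeplitz c * V = 1) (hVT : V * toeplitz c = 1) :
    entry (V * toeplitz d * V) 0 0 = entry V 0 0 * fourierCoeff b 0 := by
  set x := V (e 0) with hx
  set y := star V (e 0) with hy
  set f := hardyEmb x with hf
  set g := hardyEmb y with hg
  have hTx : toeplitz c x = e 0 := by
    have := congrArg (fun X : Ell2 →L[ℂ] Ell2 => X (e 0)) hTV
    simpa using this
  have hTy : toeplitz (star c) y = e 0 := by
    have := congrArg (fun X : Ell2 →L[ℂ] Ell2 => star X (e 0)) hVT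
    rw [← star_toeplitz]
    simpa using this
  have hfn : ∀ n < 0, fourierCoeff f n = 0 := fun n hn => fourierCoeff_hardyEmb_neg x hn
  have hgn : ∀ n < 0, fourierCoeff g n = 0 := fun n hn => fourierCoeff_hardyEmb_neg y hn
  have hu : ∀ n, 0 ≤ n → fourierCoeff (mulOp c f) n = if n = 0 then 1 else 0 := fun n hn => by
    lift n to ℕ using hn
    rw [← hardyProj_apply, hf, ← toeplitz_apply, hTx, e_apply]
    simp
  have hw : ∀ n, 0 ≤ n → fourierCoeff (mulOp (star c) g) n = if n = 0 then 1 else 0 :=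
      fun n hn => by
    lift n to ℕ using hn
    rw [← hardyProj_apply, hg, ← toeplitz_apply, hTy, e_apply]
    simp
  have heq : (fun x => conj (g x) * mulOp c f x) =ᵐ[haarAddCircle]
      fun x => conj (mulOp (star c) g x) * f x := by
    filter_upwards [coeFn_mulOp c f, coeFn_mulOp (star c) g, Lp.coeFn_star c] with x h1 h2 h3
    rw [h1, h2, h3]
    simp
    ring
  -- Here `cf` and `c̄g` each equal 1 plus negative frequencies. The two factorizations of `ḡcf`
  -- leave only the frequency 0, so `ḡcf` is constant and the entry `∫ b·ḡcf` is a multiple of `b₀`.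
  have hconst := ae_eq_const_of_fourierCoeff (integrable_conj_mul g (mulOp c f)) fun n hn => by
    rcases lt_or_gt_of_ne hn with h | h
    · rw [fourierCoeff_congr_ae heq]
      refine fourierCoeff_conj_mul_eq_zero fun k => ?_
      rcases lt_or_ge k 0 with hk | hk
      · exact Or.inr (hfn _ hk)
      · exact Or.inl (by rw [hw _ (by omega), if_neg (by omega)])
    · refine fourierCoeff_conj_mul_eq_zero fun k => ?_
      rcases le_or_gt k 0 with hk | hk
      · exact Or.inl (hgn _ (by omega))
      · exact Or.inr (by rw [hu _ hk.le, if_neg hk.ne'])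
  have hval : fourierCoeff (fun x => conj (g x) * mulOp c f x) 0 = entry V 0 0 := by
    rw [fourierCoeff_congr_ae heq, fourierCoeff_conj_mul_zero, hw 0 le_rfl]
    · have := fourierCoeff_hardyEmb x 0
      rw [Nat.cast_zero] at this
      rw [hf, this]
      simp [entry, hx]
    · intro k hk
      rcases lt_or_gt_of_ne hk with h | h
      · exact Or.inr (hfn k h)
      · exact Or.inl (by rw [hw k h.le, if_neg hk])
  rw [hval] at hconst
  have h1 : entry (V * toeplitz d * V) 0 0 = inner ℂ g (mulOp d f) := by
    rw [entry, ← inner_e, mul_apply_eq_comp, mul_apply_eq_comp, ← hx,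
      ← ContinuousLinearMap.adjoint_inner_left, ← ContinuousLinearMap.star_eq_adjoint, ← hy,
      toeplitz_apply, hardyProj, ContinuousLinearMap.adjoint_inner_right]
    rfl
  rw [h1, mulOp_congr_mul hd, mul_apply_eq_comp, inner_mulOp_right, fourierCoeff,
    ← integral_const_mul]
  refine integral_congr_ae ?_
  filter_upwards [hconst] with x hx
  rw [hx]
  simp [mul_comm]

/-! ### Hilbert–Schmidt operators and Hankel operators -/

section HilbertSchmidt

variable {F : Type*} [NormedAddCommGroup F] [NormedSpace ℂ F]

/-- Cauchy–Schwarz on the partial sums of the basis expansion: the Hilbert–Schmidt norm dominates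
the operator norm. -/
theorem norm_le_of_hasSum_sq {X : Ell2 →L[ℂ] F} {S : ℝ} (h : HasSum (fun k => ‖X (e k)‖ ^ 2) S) :
    ‖X‖ ≤ √S := by
  refine X.opNorm_le_bound (Real.sqrt_nonneg _) fun v => ?_
  have hlim := ((X.hasSum (hasSum_e v)).tendsto_sum_nat).norm
  refine le_of_tendsto hlim (Eventually.of_forall fun N => ?_)
  have hv : ∑ k ∈ Finset.range N, ‖v k‖ ^ 2 ≤ ‖v‖ ^ 2 := by
    have := lp.sum_rpow_le_norm_rpow (p := 2) (by norm_num) v (Finset.range N)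
    simpa using this
  have hX : ∑ k ∈ Finset.range N, ‖X (e k)‖ ^ 2 ≤ S :=
    sum_le_hasSum _ (fun _ _ => sq_nonneg _) h
  calc ‖∑ k ∈ Finset.range N, X (v k • e k)‖
      ≤ ∑ k ∈ Finset.range N, ‖X (e k)‖ * ‖v k‖ := by
        refine (norm_sum_le _ _).trans (Finset.sum_le_sum fun k _ => ?_)
        rw [map_smul, norm_smul, mul_comm]
    _ ≤ √(∑ k ∈ Finset.range N, ‖X (e k)‖ ^ 2) * √(∑ k ∈ Finset.range N, ‖v k‖ ^ 2) :=
        Real.sum_mul_le_sqrt_mul_sqrt _ _ _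
    _ ≤ √S * ‖v‖ := by
        gcongr
        exact Real.sqrt_le_iff.2 ⟨norm_nonneg _, hv⟩

theorem P_e (n k : ℕ) : P n (e k) = if k < n then e k else 0 := by
  refine ell2_ext fun i => ?_
  rw [P_apply, e_apply]
  split_ifs <;> simp_all [e_apply]; omega

theorem isCompactOperator_P (n : ℕ) : IsCompactOperator (P n) := by
  refine Submodule.sum_mem (compactOperator (RingHom.id ℂ) Ell2 Ell2) fun k _ => ?_
  exact (isCompactOperator_of_locallyCompactSpace_dom (innerSL ℂ (e k))).clm_comp
    (ContinuousLinearMap.toSpanSingleton ℂ (e k))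

/-- The truncations `X P_n` have finite rank, and the tails of the series bound the squared norms of
`X P_n - X`. -/
theorem isCompactOperator_of_summable_sq [CompleteSpace F] {X : Ell2 →L[ℂ] F}
    (h : Summable fun k => ‖X (e k)‖ ^ 2) : IsCompactOperator X := by
  have hlim : Tendsto (fun n => X ∘L P n) atTop (𝓝 X) := by
    rw [tendsto_iff_norm_sub_tendsto_zero]
    have hS : ∀ n, HasSum (fun k => ‖(X ∘L P n - X) (e k)‖ ^ 2)
        ((∑' k, ‖X (e k)‖ ^ 2) - ∑ k ∈ Finset.range n, ‖X (e k)‖ ^ 2) := fun n => by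
      have h1 : HasSum (fun k => if k < n then ‖X (e k)‖ ^ 2 else 0)
          (∑ k ∈ Finset.range n, ‖X (e k)‖ ^ 2) := by
        have := hasSum_sum_of_ne_finset_zero (L := SummationFilter.unconditional ℕ)
          (s := Finset.range n) (f := fun k => if k < n then ‖X (e k)‖ ^ 2 else 0) (fun k hk => if_neg (by simpa using hk))
        rwa [Finset.sum_congr rfl fun k hk => if_pos (Finset.mem_range.1 hk)] at this
      have h2 := h.hasSum.sub h1
      have hk : ∀ k, ‖(X ∘L P n - X) (e k)‖ ^ 2 =
          ‖X (e k)‖ ^ 2 - if k < n then ‖X (e k)‖ ^ 2 else 0 := fun k => by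
        rw [sub_apply, ContinuousLinearMap.comp_apply, P_e]
        split_ifs <;> simp
      simp only [hk]
      exact h2
    refine squeeze_zero (fun _ => norm_nonneg _) (fun n => norm_le_of_hasSum_sq (hS n)) ?_
    have := (h.hasSum.tendsto_sum_nat.const_sub (∑' k, ‖X (e k)‖ ^ 2)).sqrt
    simpa using this
  exact isCompactOperator_of_tendsto hlim
    (Eventually.of_forall fun n => (isCompactOperator_P n).clm_comp X)

end HilbertSchmidt

theorem hasSum_norm_sq_fourierCoeff (u : L2) :
    HasSum (fun n => ‖fourierCoeff u n‖ ^ 2) (‖u‖ ^ 2) := by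
  have h := lp.hasSum_norm (p := 2) (by norm_num) (fourierBasis.repr u)
  simpa [fourierBasis_repr] using h

/-- The Hankel operator of `b`: multiplication by `b`, restricted to the Hardy space and followed by
the projection onto its orthogonal complement. -/
def hankel (b : Linf) : Ell2 →L[ℂ] L2 :=
  mulOp b ∘L hardyEmb.toContinuousLinearMap
    - hardyEmb.toContinuousLinearMap ∘L toeplitz b

theorem hankel_apply (b : Linf) (x : Ell2) :
    hankel b x = mulOp b (hardyEmb x) - hardyEmb (toeplitz b x) := rfl

/-- The defect of multiplicativity comes from the part of `b·f` outside the Hardy space, which is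
what `hankel b` records. -/
theorem toeplitz_mul {a b d : Linf} (h : (d : T → ℂ) =ᵐ[haarAddCircle] fun x => a x * b x) :
    toeplitz d = toeplitz a * toeplitz b + hardyProj ∘L mulOp a ∘L hankel b := by
  ext1 x
  simp only [add_apply, mul_apply_eq_comp, ContinuousLinearMap.comp_apply, hankel_apply, map_sub]
  rw [toeplitz_apply, mulOp_congr_mul h, toeplitz_apply a, mul_apply_eq_comp]
  abel

theorem fourierCoeff_mulOp_hardyEmb_e (b : Linf) (k : ℕ) (n : ℤ) :
    fourierCoeff (mulOp b (hardyEmb (e k))) n = fourierCoeff b (n - k) := by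
  rw [hardyEmb_e, fourierCoeff, fourierCoeff]
  refine integral_congr_ae ?_
  filter_upwards [coeFn_mulOp b (fourierLp 2 (k : ℤ)), coeFn_fourierLp (T := 2 * Real.pi) 2 (k : ℤ)]
    with x h1 h2
  rw [h1, h2, neg_sub, sub_eq_add_neg, fourier_add, smul_eq_mul, smul_eq_mul]
  ring

theorem fourierCoeff_sub (u v : L2) (n : ℤ) :
    fourierCoeff ((u - v : L2) : T → ℂ) n = fourierCoeff u n - fourierCoeff v n := by
  simp only [fourierCoeff_eq_inner, inner_sub_right]

theorem fourierCoeff_hankel_e (b : Linf) (k n : ℕ) : fourierCoeff (hankel b (e k)) n = 0 := by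
  rw [hankel_apply, fourierCoeff_sub, fourierCoeff_hardyEmb, toeplitz_apply, hardyProj_apply,
    sub_self]

theorem fourierCoeff_hankel_e_neg (b : Linf) (k n : ℕ) :
    fourierCoeff (hankel b (e k)) (-(n + 1)) = fourierCoeff b (-((k + n : ℕ) + 1)) := by
  rw [hankel_apply, fourierCoeff_sub, fourierCoeff_hardyEmb_neg _ (by omega), sub_zero,
    fourierCoeff_mulOp_hardyEmb_e]
  congr 1
  push_cast
  ring

theorem summable_norm_sq_hankel {b : Linf} (hb : MemKrein b) :
    Summable fun k => ‖hankel b (e k)‖ ^ 2 := by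
  have hinj : Function.Injective fun n : ℕ => -((n : ℤ) + 1) := fun m n h => by
    simp only at h
    omega
  have h1 : Summable fun n : ℕ => ((n : ℝ) + 1) * ‖fourierCoeff b (-((n : ℤ) + 1))‖ ^ 2 := by
    refine Summable.of_nonneg_of_le (fun n => by positivity) (fun n => ?_) (hb.comp_injective hinj)
    simp only [Function.comp_apply, halfTerm]
    refine mul_le_mul_of_nonneg_right ?_ (sq_nonneg _)
    push_cast
    rw [abs_neg, abs_of_nonneg (by positivity)]
    linarith
  have h2 : Summable fun p : ℕ × ℕ => ‖fourierCoeff b (-((p.1 + p.2 : ℕ) + 1))‖ ^ 2 := by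
    -- The summand is constant on each antidiagonal, and the one with sum `n` has `n + 1` points:
    -- this is the source of the weight in the Krein norm.
    rw [← Finset.HasAntidiagonal.sigmaAntidiagonalEquivProd.summable_iff]
    refine (summable_sigma_of_nonneg fun _ => sq_nonneg _).2 ⟨fun n => Summable.of_finite, ?_⟩
    convert h1 using 2 with n
    rw [tsum_fintype, Finset.sum_congr rfl (g := fun _ =>
      ‖fourierCoeff b (-((n : ℤ) + 1))‖ ^ 2)]
    · simp
    · rintro ⟨⟨i, j⟩, hij⟩ -
      have hij' := Finset.HasAntidiagonal.mem_antidiagonal.1 hij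
      simp only [Finset.HasAntidiagonal.sigmaAntidiagonalEquivProd_apply, hij']
  refine h2.prod.congr fun k => ?_
  refine (hasSum_norm_sq_fourierCoeff (hankel b (e k))).unique ?_ |>.symm
  rw [← zero_add (∑' _, _)]
  refine HasSum.of_nat_of_neg_add_one ?_ ?_
  · simp only [fourierCoeff_hankel_e]
    simp
  · simp only [fourierCoeff_hankel_e_neg]
    exact (h2.prod_factor k).hasSum

theorem isCompactOperator_hankel {b : Linf} (hb : MemKrein b) : IsCompactOperator (hankel b) :=
  isCompactOperator_of_summable_sq (summable_norm_sq_hankel hb)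

/-! ### Invertibility -/

/-- Otherwise there are unit vectors with `A xₙ → 0`. Since `xₙ = R A xₙ + K xₙ`, compactness makes
a subsequence converge to a unit vector in the kernel of `A`. -/
theorem exists_lower_bound_of_compact {A R K : Ell2 →L[ℂ] Ell2} (hRA : 1 = R * A + K)
    (hK : IsCompactOperator K) (hA : ∀ x, A x = 0 → x = 0) :
    ∃ c > 0, ∀ x, c * ‖x‖ ≤ ‖A x‖ := by
  by_contra! hcon
  have hseq : ∀ n : ℕ, ∃ x : Ell2, ‖x‖ = 1 ∧ ‖A x‖ ≤ 1 / ((n : ℝ) + 1) := fun n => by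
    obtain ⟨x, hx⟩ := hcon (1 / ((n : ℝ) + 1)) Nat.one_div_pos_of_nat
    have hx0 : x ≠ 0 := by
      rintro rfl
      simp at hx
    have hpos : 0 < ‖x‖ := norm_pos_iff.2 hx0
    refine ⟨((‖x‖⁻¹ : ℝ) : ℂ) • x, ?_, ?_⟩
    · rw [norm_smul, Complex.norm_real, norm_inv, norm_norm, inv_mul_cancel₀ hpos.ne']
    · rw [map_smul, norm_smul, Complex.norm_real, norm_inv, norm_norm, inv_mul_le_iff₀ hpos,
        mul_comm]
      exact hx.le
  choose x hx1 hx2 using hseq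
  have hAx : Tendsto (fun n => A (x n)) atTop (𝓝 0) :=
    squeeze_zero_norm hx2 tendsto_one_div_add_atTop_nhds_zero_nat
  obtain ⟨C, hC, hKC⟩ := hK.image_closedBall_subset_compact (f := K.toLinearMap) 1
  obtain ⟨z, -, φ, hφ, hz⟩ := hC.tendsto_subseq (x := fun n => K (x n)) fun n =>
    hKC ⟨x n, by simp [hx1], rfl⟩
  have hAxφ := hAx.comp hφ.tendsto_atTop
  have hxz : Tendsto (x ∘ φ) atTop (𝓝 z) := by
    have h1 := ((R.continuous.tendsto _).comp hAxφ).add hz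
    rw [map_zero, zero_add] at h1
    refine h1.congr fun n => ?_
    have := congrArg (fun X : Ell2 →L[ℂ] Ell2 => X (x (φ n))) hRA
    simpa using this.symm
  have hz1 : ‖z‖ = 1 := by
    refine tendsto_nhds_unique hxz.norm ?_
    simp [hx1]
  have hz0 : z = 0 := hA z (tendsto_nhds_unique ((A.continuous.tendsto _).comp hxz) hAxφ)
  simp [hz0] at hz1

/-- An invertible `u` within `c / 2` of `A` inherits the lower bound `c / 2`, so `‖u⁻¹‖ ≤ 2 / c` and
`A = u (1 - u⁻¹ (u - A))` is inverted by a Neumann series. -/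
theorem isUnit_of_mem_closure_of_lower_bound {A : Ell2 →L[ℂ] Ell2}
    (hcl : A ∈ closure {X : Ell2 →L[ℂ] Ell2 | IsUnit X}) {c : ℝ} (hc : 0 < c)
    (hA : ∀ x, c * ‖x‖ ≤ ‖A x‖) : IsUnit A := by
  obtain ⟨_, ⟨u, rfl⟩, hu⟩ := Metric.mem_closure_iff.1 hcl (c / 2) (half_pos hc)
  rw [dist_comm, dist_eq_norm] at hu
  have hinv : ‖(↑u⁻¹ : Ell2 →L[ℂ] Ell2)‖ ≤ 2 / c := by
    refine ContinuousLinearMap.opNorm_le_bound _ (by positivity) fun y => ?_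
    set x := (↑u⁻¹ : Ell2 →L[ℂ] Ell2) y with hx
    have hux : (u : Ell2 →L[ℂ] Ell2) x = y := by
      rw [hx, ← mul_apply_eq_comp, u.mul_inv, one_apply_eq_self]
    have h1 : ‖A x‖ ≤ ‖y‖ + c / 2 * ‖x‖ := by
      have h2 : A x = y - ((u : Ell2 →L[ℂ] Ell2) - A) x := by
        rw [sub_apply, hux]; abel
      rw [h2]
      refine (norm_sub_le _ _).trans (add_le_add le_rfl ?_)
      exact (ContinuousLinearMap.le_opNorm _ _).trans
        (mul_le_mul_of_nonneg_right hu.le (norm_nonneg _))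
    have h3 := hA x
    rw [div_mul_eq_mul_div, le_div_iff₀ hc]
    linarith
  have hlt : ‖(↑u⁻¹ : Ell2 →L[ℂ] Ell2) * (u - A)‖ < 1 := by
    refine (norm_mul_le _ _).trans_lt ?_
    calc _ ≤ 2 / c * ‖(u : Ell2 →L[ℂ] Ell2) - A‖ := by gcongr
      _ < 2 / c * (c / 2) := by gcongr
      _ = 1 := by field_simp
  have := u.isUnit.mul (isUnit_one_sub_of_norm_lt_one hlt)
  rwa [mul_sub, mul_one, ← mul_assoc, u.mul_inv, one_mul, sub_sub_cancel] at this

theorem toeplitz_eq_one {d : Linf} (hd : (d : T → ℂ) =ᵐ[haarAddCircle] fun _ => 1) :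
    toeplitz d = 1 := by
  refine clm_ext_e fun k => ell2_ext fun j => ?_
  rw [toeplitz_apply, hardyProj_apply, one_apply_eq_self]
  have : mulOp d (hardyEmb (e k)) = hardyEmb (e k) := by
    refine Lp.ext ?_
    filter_upwards [coeFn_mulOp d (hardyEmb (e k)), hd] with x h1 h2
    rw [h1, h2, one_mul]
  rw [this, fourierCoeff_hardyEmb]

theorem memKrein_star {a : Linf} (ha : MemKrein a) : MemKrein (star a) := by
  have h : ∀ n, fourierCoeff (star a : Linf) n = conj (fourierCoeff a (-n)) := fun n => by
    rw [fourierCoeff, fourierCoeff, ← integral_conj]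
    refine integral_congr_ae ?_
    filter_upwards [Lp.coeFn_star a] with x hx
    rw [hx]
    simp only [smul_eq_mul, map_mul, ← fourier_neg, neg_neg]
    rfl
  have h2 := ha.comp_injective neg_injective
  refine h2.congr fun n => ?_
  simp [halfTerm, h]

theorem toeplitz_lower_bound {a a' d : Linf} (hd : (d : T → ℂ) =ᵐ[haarAddCircle] fun _ => 1)
    (hmul : (d : T → ℂ) =ᵐ[haarAddCircle] fun x => a' x * a x)
    (ha : MemKrein a) (hinj : ∀ x, toeplitz a x = 0 → x = 0) :
    ∃ c > 0, ∀ x, c * ‖x‖ ≤ ‖toeplitz a x‖ := by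
  have h := toeplitz_mul hmul
  rw [toeplitz_eq_one hd] at h
  exact exists_lower_bound_of_compact h
    ((isCompactOperator_hankel ha).clm_comp (hardyProj ∘L mulOp a')) hinj

/-- A Toeplitz operator with an invertible symbol in the Krein algebra is invertible if it is a
limit of invertible operators. -/
theorem isUnit_toeplitz_of_mem_closure {a a' d : Linf}
    (hd : (d : T → ℂ) =ᵐ[haarAddCircle] fun _ => 1)
    (hmul : (d : T → ℂ) =ᵐ[haarAddCircle] fun x => a' x * a x) (ha : MemKrein a)
    (hcl : toeplitz a ∈ closure {X : Ell2 →L[ℂ] Ell2 | IsUnit X}) : IsUnit (toeplitz a) := by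
  have hne : ∀ᵐ x ∂(haarAddCircle : Measure T), a x ≠ 0 := by
    filter_upwards [hd, hmul] with x h1 h2 h3
    rw [h1, h3, mul_zero] at h2
    exact one_ne_zero h2
  rcases coburn hne with hinj | hinj
  · obtain ⟨c, hc, h⟩ := toeplitz_lower_bound hd hmul ha hinj
    exact isUnit_of_mem_closure_of_lower_bound hcl hc h
  · rw [star_toeplitz] at hinj
    have hd' : ((star d : Linf) : T → ℂ) =ᵐ[haarAddCircle] fun _ => 1 := by
      filter_upwards [hd, Lp.coeFn_star d] with x h1 h2
      rw [h2, Pi.star_apply, h1, star_one]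
    have hmul' : ((star d : Linf) : T → ℂ) =ᵐ[haarAddCircle]
        fun x => (star a' : Linf) x * (star a : Linf) x := by
      filter_upwards [hmul, Lp.coeFn_star d, Lp.coeFn_star a, Lp.coeFn_star a'] with x h1 h2 h3 h4
      rw [h2, h3, h4, Pi.star_apply, Pi.star_apply, Pi.star_apply, h1, star_mul']
    obtain ⟨c, hc, h⟩ := toeplitz_lower_bound hd' hmul' (memKrein_star ha) hinj
    have hcl' : toeplitz (star a) ∈ closure {X : Ell2 →L[ℂ] Ell2 | IsUnit X} := by
      rw [← star_toeplitz]
      exact map_mem_closure continuous_star hcl fun X hX => hX.star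
    have := (isUnit_of_mem_closure_of_lower_bound hcl' hc h).star
    rwa [star_toeplitz, star_star] at this

/-! ### Suitable Banach algebras -/

/-- The map `a ↦ T(a)` as a continuous linear map. -/
def toeplitzL : Linf →L[ℂ] (Ell2 →L[ℂ] Ell2) :=
  (ContinuousLinearMap.compL ℂ Ell2 L2 Ell2 hardyProj) ∘L
    ((ContinuousLinearMap.compL ℂ Ell2 L2 L2).flip hardyEmb.toContinuousLinearMap) ∘L
      ((ContinuousLinearMap.mul ℂ ℂ).holderL haarAddCircle ∞ 2 2)

theorem entry_eq_inner (A : Ell2 →L[ℂ] Ell2) (j k : ℕ) :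
    entry A j k = innerSL ℂ (e j) (ContinuousLinearMap.apply ℂ Ell2 (e k) A) := by
  rw [innerSL_apply_apply, inner_e]
  rfl

section Algebra

variable {B : Type*} [NormedRing B] [NormedAlgebra ℂ B] {ι : B →L[ℂ] Linf}

theorem IsBanachAlgEmbedding.map_pow (hι : IsBanachAlgEmbedding ι) (b : B) (n : ℕ) :
    (ι (b ^ n) : T → ℂ) =ᵐ[haarAddCircle] fun x => ι b x ^ n := by
  induction n with
  | zero => simpa using hι.map_one
  | succ n ih =>
    filter_upwards [ih, hι.map_mul (b ^ n) b] with x h1 h2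
    rw [pow_succ, h2, h1, pow_succ]

theorem IsBanachAlgEmbedding.map_partialSum (hι : IsBanachAlgEmbedding ι) (b : B) (n : ℕ) :
    (ι (∑ k ∈ Finset.range n, ((k.factorial : ℂ)⁻¹) • b ^ k) : T → ℂ) =ᵐ[haarAddCircle]
      fun x => ∑ k ∈ Finset.range n, ((k.factorial : ℂ)⁻¹) • ι b x ^ k := by
  induction n with
  | zero =>
    rw [Finset.sum_range_zero, map_zero]
    exact Lp.coeFn_zero ℂ ∞ (haarAddCircle : Measure T)
  | succ n ih =>
    rw [Finset.sum_range_succ, map_add, map_smul]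
    filter_upwards [ih, hι.map_pow b n, Lp.coeFn_add
      (ι (∑ k ∈ Finset.range n, ((k.factorial : ℂ)⁻¹) • b ^ k))
      (((n.factorial : ℂ)⁻¹) • ι (b ^ n)),
      Lp.coeFn_smul ((n.factorial : ℂ)⁻¹) (ι (b ^ n))] with x h1 h2 h3 h4
    rw [h3, Pi.add_apply, h4, Pi.smul_apply, h1, h2, Finset.sum_range_succ]

/-! ### Exponentials, the value of `G` on them, and equicontinuity -/

variable [CompleteSpace B]

theorem exp_mul_exp_neg (b : B) : NormedSpace.exp b * NormedSpace.exp (-b) = 1 := by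
  let : NormedAlgebra ℚ B := NormedAlgebra.restrictScalars ℚ ℂ B
  rw [← NormedSpace.exp_add_of_commute (Commute.neg_right (Commute.refl b)), add_neg_cancel,
    NormedSpace.exp_zero]

theorem ringInverse_exp (b : B) : Ring.inverse (NormedSpace.exp b) = NormedSpace.exp (-b) := by
  let : NormedAlgebra ℚ B := NormedAlgebra.restrictScalars ℚ ℂ B
  exact Ring.inverse_exp b

/-- The partial sums converge in `L^∞`, so a subsequence converges almost everywhere; its pointwise
limit is the scalar exponential series. -/
theorem IsBanachAlgEmbedding.map_exp (hι : IsBanachAlgEmbedding ι) (b : B) :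
    (ι (NormedSpace.exp b) : T → ℂ) =ᵐ[haarAddCircle] fun x => Complex.exp (ι b x) := by
  have h1 : Tendsto (fun n => ι (∑ k ∈ Finset.range n, ((k.factorial : ℂ)⁻¹) • b ^ k)) atTop
      (𝓝 (ι (NormedSpace.exp b))) :=
    (ι.continuous.tendsto _).comp (NormedSpace.exp_series_hasSum_exp' (𝕂 := ℂ) b).tendsto_sum_nat
  obtain ⟨ns, hns, hae⟩ := (tendstoInMeasure_of_tendsto_Lp h1).exists_seq_tendsto_ae
  filter_upwards [hae, ae_all_iff.2 (hι.map_partialSum b)] with x h2 h3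
  have h4 := ((NormedSpace.exp_series_hasSum_exp' (𝕂 := ℂ) (ι b x)).tendsto_sum_nat).comp
    hns.tendsto_atTop
  rw [← Complex.exp_eq_exp_ℂ] at h4
  refine tendsto_nhds_unique h2 (h4.congr fun n => ?_)
  rw [h3]
  rfl

theorem hasDerivAt_toeplitz_exp (ι : B →L[ℂ] Linf) (b : B) (t : ℂ) :
    HasDerivAt (fun s : ℂ => toeplitz (ι (NormedSpace.exp (s • b))))
      (toeplitz (ι (b * NormedSpace.exp (t • b)))) t :=
  (toeplitzL ∘L ι).hasFDerivAt.comp_hasDerivAt t (hasDerivAt_exp_smul_const' b t)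

/-- A connectedness argument along `s ↦ e^{sb}`, starting from `T(1) = 1`. -/
theorem IsSuitable.isUnit_toeplitz_exp (hι : IsBanachAlgEmbedding ι) (hB : IsSuitable ι) (b : B) :
    IsUnit (toeplitz (ι (NormedSpace.exp b))) := by
  have hcont : Continuous fun s : ℂ => toeplitz (ι (NormedSpace.exp (s • b))) :=
    continuous_iff_continuousAt.2 fun t => (hasDerivAt_toeplitz_exp ι b t).continuousAt
  obtain ⟨C, hC⟩ := hB.krein
  let U : Set ℂ := {s | IsUnit (toeplitz (ι (NormedSpace.exp (s • b))))}
  have hopen : IsOpen U := Units.isOpen.preimage hcont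
  have hclosed : IsClosed U := by
    refine isClosed_of_closure_subset fun t ht => ?_
    have hcl := map_mem_closure hcont ht (t := {X | IsUnit X}) fun s hs => hs
    refine isUnit_toeplitz_of_mem_closure hι.map_one (a' := ι (NormedSpace.exp (-(t • b)))) ?_
      (hC _).1 hcl
    have := exp_mul_exp_neg (-(t • b))
    rw [neg_neg] at this
    rw [← this]
    exact hι.map_mul _ _
  have h0 : (0 : ℂ) ∈ U := by
    change IsUnit _
    rw [zero_smul, NormedSpace.exp_zero, toeplitz_eq_one hι.map_one]
    exact isUnit_one
  have h1 : (1 : ℂ) ∈ U := by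
    rw [IsClopen.eq_univ ⟨hclosed, hopen⟩ ⟨0, h0⟩]
    trivial
  simpa [U] using h1

theorem IsSuitable.entry_inverse_toeplitz_exp (hι : IsBanachAlgEmbedding ι) (hB : IsSuitable ι)
    (b : B) (t : ℂ) :
    entry (Ring.inverse (toeplitz (ι (NormedSpace.exp (t • b))))) 0 0 =
      Complex.exp (-(t * fourierCoeff (ι b) 0)) := by
  set β := fourierCoeff (ι b) 0 with hβ
  set ψ : ℂ → ℂ := fun s => entry (Ring.inverse (toeplitz (ι (NormedSpace.exp (s • b))))) 0 0
    with hψ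
  have hderiv : ∀ s, HasDerivAt ψ (-(ψ s * β)) s := fun s => by
    obtain ⟨u, hu⟩ := hB.isUnit_toeplitz_exp hι (s • b)
    have h1 := hasDerivAt_toeplitz_exp ι b s
    have h2 := hasFDerivAt_ringInverse (𝕜 := ℂ) u
    rw [hu] at h2
    have h3 := h2.comp_hasDerivAt s h1
    have h4 := ((innerSL ℂ (e 0)) ∘L
      (ContinuousLinearMap.apply ℂ Ell2 (e 0))).hasFDerivAt.comp_hasDerivAt s h3
    have h5 : ψ = (innerSL ℂ (e 0) ∘L ContinuousLinearMap.apply ℂ Ell2 (e 0)) ∘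
        (Ring.inverse ∘ fun s => toeplitz (ι (NormedSpace.exp (s • b)))) :=
      funext fun s => entry_eq_inner _ 0 0
    rw [h5]
    refine h4.congr_deriv ?_
    rw [← h5, neg_apply, map_neg, ContinuousLinearMap.mulLeftRight_apply,
      ContinuousLinearMap.comp_apply, ← entry_eq_inner,
      entry_inv_mul_toeplitz_mul_inv (hι.map_mul _ _) (by rw [← hu, u.mul_inv])
        (by rw [← hu, u.inv_mul])]
    simp only [hψ]
    rw [← hu, Ring.inverse_unit]
  -- The integrating factor for `ψ' = -βψ`.
  have hconst : ∀ s, HasDerivAt (fun s => ψ s * Complex.exp (s * β)) 0 s := fun s => by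
    have h1 := (hderiv s).mul ((hasDerivAt_mul_const β (x := s)).cexp)
    refine h1.congr_deriv ?_
    ring
  have h := is_const_of_deriv_eq_zero (fun s => (hconst s).differentiableAt)
    (fun s => (hconst s).deriv) t 0
  have h0 : ψ 0 = 1 := by
    simp only [hψ, zero_smul, NormedSpace.exp_zero, toeplitz_eq_one hι.map_one, Ring.inverse_one]
    simp [entry, e_apply]
  rw [h0, zero_mul, Complex.exp_zero, mul_one] at h
  rw [Complex.exp_neg]
  exact eq_inv_of_mul_eq_one_left h

theorem equicontinuousOn_kozak (hB : IsSuitable ι) :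
    EquicontinuousOn (fun (n : ℕ) (a : B) => kozak (toeplitz (ι (Ring.inverse a)))
      (toeplitzInv ι a) n) (Phi ι) := by
  intro a ha
  obtain ⟨u, hu⟩ := (hB.inverse a ha).1
  obtain ⟨v, hv⟩ := (hB.inverse a ha).2
  have hinv : ContinuousAt (Ring.inverse : B → B) a := hu ▸ NormedRing.inverse_continuousAt u
  have hT : Tendsto (fun x : B => toeplitz (ι (Ring.inverse x))) (𝓝 a)
      (𝓝 (toeplitz (ι (Ring.inverse a)))) :=
    ((toeplitzL ∘L ι).continuous.tendsto _).comp hinv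
  have hVc : ContinuousAt (Ring.inverse : (Ell2 →L[ℂ] Ell2) → _) (toeplitz (ι (Ring.inverse a))) :=
    hv ▸ NormedRing.inverse_continuousAt v
  have hV : Tendsto (fun x : B => toeplitzInv ι x) (𝓝 a) (𝓝 (toeplitzInv ι a)) :=
    Tendsto.comp hVc hT
  have hT0 := (tendsto_iff_norm_sub_tendsto_zero.1 hT)
  have hV0 := (tendsto_iff_norm_sub_tendsto_zero.1 hV)
  have hlim := hT0.add ((((hT0.mul hV.norm).mul hT.norm).add
    ((hV0.const_mul ‖toeplitz (ι (Ring.inverse a))‖).mul hT.norm)).add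
    (hT0.const_mul (‖toeplitz (ι (Ring.inverse a))‖ * ‖toeplitzInv ι a‖)))
  simp only [zero_mul, mul_zero, add_zero] at hlim
  -- `kozak` is built with `Ring.inverse`, which is continuous at units, so the estimate holds on a
  -- full neighbourhood of `a`.
  refine EquicontinuousAt.equicontinuousWithinAt ?_ _
  rw [Metric.equicontinuousAt_iff_right]
  intro ε hε
  filter_upwards [hlim.eventually (gt_mem_nhds hε)] with x hx n
  rw [dist_comm, dist_eq_norm]
  exact (norm_kozak_sub_le _ _ _ _ n).trans_lt hx

end Algebra

end Szego

end

theorem proposition4p3 {B : Type*} [NormedRing B] [NormedAlgebra ℂ B] [CompleteSpace B]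
    (ι : B →L[ℂ] Szego.Linf) (hι : Szego.IsBanachAlgEmbedding ι) (hB : Szego.IsSuitable ι) :
    (∀ a ∈ Szego.Phi ι,
      Szego.G ι a ≠ 0 ∧
      (∀ n : ℕ, (Szego.corner n (Szego.A ι n a)).det = Szego.G ι a ^ n) ∧
      (∀ x : Szego.Ell2, Tendsto (fun n : ℕ => Szego.sectionInv n (Szego.A ι n a) x) atTop
        (𝓝 (Szego.toeplitz (ι (Ring.inverse a)) x))) ∧
      (∀ x : Szego.Ell2, Tendsto
        (fun n : ℕ => Szego.sectionInv n (ContinuousLinearMap.adjoint (Szego.A ι n a)) x) atTop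
        (𝓝 (ContinuousLinearMap.adjoint (Szego.toeplitz (ι (Ring.inverse a))) x)))) ∧
    EquicontinuousOn (fun (n : ℕ) (a : B) => Szego.sectionInv n (Szego.A ι n a)) (Szego.Phi ι) ∧
    (∀ b : B,
      NormedSpace.exp b ∈ Szego.Phi ι ∧
      ((ι (NormedSpace.exp b) : Szego.T → ℂ) =ᵐ[AddCircle.haarAddCircle]
        fun x => Complex.exp (ι b x)) ∧
      Szego.G ι (NormedSpace.exp b) = Complex.exp (fourierCoeff (ι b : Szego.T → ℂ) 0)) := by
  have hinv : ∀ a ∈ Szego.Phi ι,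
      Szego.toeplitz (ι (Ring.inverse a)) * Szego.toeplitzInv ι a = 1 ∧
      Szego.toeplitzInv ι a * Szego.toeplitz (ι (Ring.inverse a)) = 1 := fun a ha =>
    ⟨Ring.mul_inverse_cancel _ (hB.inverse a ha).2, Ring.inverse_mul_cancel _ (hB.inverse a ha).2⟩
  have hsec : ∀ a ∈ Szego.Phi ι, ∀ n, Szego.sectionInv n (Szego.A ι n a) =
      Szego.kozak (Szego.toeplitz (ι (Ring.inverse a))) (Szego.toeplitzInv ι a) n := fun a ha n =>
    (Szego.isToeplitz_toeplitz _).sectionInv_eq_kozak (hinv a ha).1 (hinv a ha).2 n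
  refine ⟨fun a ha => ⟨?_, fun n => ?_, fun x => ?_, fun x => ?_⟩, ?_, fun b => ⟨?_, ?_, ?_⟩⟩
  · exact (Szego.isToeplitz_toeplitz _).entry_inv_ne_zero (hinv a ha).1 (hinv a ha).2
  · have h : Szego.corner n (Szego.A ι n a) = Szego.corner n (Szego.toeplitzInv ι a) :=
      Szego.corner_P_mul_mul_P n _
    rw [h]
    exact (Szego.isToeplitz_toeplitz _).det_corner_inv (hinv a ha).1 (hinv a ha).2 n
  · simp only [hsec a ha]
    exact Szego.tendsto_kozak _ _ x
  · have h : ∀ n, Szego.sectionInv n (ContinuousLinearMap.adjoint (Szego.A ι n a)) =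
        Szego.kozak (star (Szego.toeplitz (ι (Ring.inverse a)))) (star (Szego.toeplitzInv ι a)) n :=
        fun n => by
      have hA : ContinuousLinearMap.adjoint (Szego.A ι n a) =
          Szego.P n * star (Szego.toeplitzInv ι a) * Szego.P n := by
        change star (Szego.P n * (Szego.toeplitzInv ι a * Szego.P n)) = _
        rw [star_mul, star_mul, Szego.star_P]
      rw [hA]
      refine (Szego.isToeplitz_toeplitz _).star.sectionInv_eq_kozak ?_ ?_ n
      · rw [← star_mul, (hinv a ha).2, star_one]
      · rw [← star_mul, (hinv a ha).1, star_one]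
    simp only [h]
    exact Szego.tendsto_kozak _ _ x
  · intro a ha U hU
    -- The inverse sections are identified with `kozak` only at points of `Phi ι`, hence the
    -- restriction to the neighbourhood filter within this set.
    filter_upwards [Szego.equicontinuousOn_kozak hB a ha U hU, self_mem_nhdsWithin] with x hx hxΦ n
    simp only [hsec a ha, hsec x hxΦ]
    exact hx n
  · exact hB.isUnit_toeplitz_exp hι b
  · exact hι.map_exp b
  -- `G` is defined through `T(a⁻¹)`, and the inverse of `e^b` is `e^{-b}`, so the parameter is `t =
  -- -1`.
  · have h := hB.entry_inverse_toeplitz_exp hι b (-1)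
    rw [neg_one_smul, neg_one_mul, neg_neg] at h
    rw [Szego.G, Szego.toeplitzInv, Szego.ringInverse_exp, h]
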